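/- Let $q$ be a prime power. For a nonzero polynomial $P=\sum_i a_i\theta^i\in\mathbb F_q[\theta]$ let $\mathfrak C_P$ be the twisted Carlitz module, i.e. the Anderson T-motive over $\mathbb F_q(\theta)$ with one generator $e$ over $\mathbb F_q(\theta)[\tau]$ (where $\tau\theta=\theta^q\tau$, $\tau T=T\tau$) and $Te=\theta e+P^{-1}\tau e$. Equivalently, $\mathfrak C_P=\mathbb F_q(\theta)[T]\,e$ with $\tau e=P\,(T-\theta)\,e$. Its $L$-series is $$L(\mathfrak C_P,U)=\prod_{\mathfrak P}\bigl(1-\tilde Q^{(d-1)}\cdots\tilde Q^{(1)}\tilde Q\;U^{d}\bigr)^{-1}\in\mathbb F_q[T][[U]],$$ where $\mathfrak P$ runs over the monic irreducible polynomials of $\mathbb F_q[\theta]$, $d=\deg\mathfrak P$, $\tilde Q\in(\mathbb F_q[\theta]/\mathfrak P)[T]$ is the reduction of $P\,(T-\theta)$ modulo $\mathfrak P$, and $^{(i)}$ raises all coefficients (of powers of $T$) to the power $q^i$. The analytic rank of $\mathfrak C_P$ is said to be $r$ if $L(\mathfrak C_P,U)$ is a polynomial in $U$ with a zero of order exactly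 $r$ at $U=1$. For $k\ge 0$ let $\mathfrak M(P,k)$ be the $k\times k$ matrix over $\mathbb F_q[T]$ with entries $\mathfrak M(P,k)_{i,j}=a_{iq-j}T-a_{iq-j-1}$ for $1\le i,j\le k$, where $a_s=0$ if $s<0$ or $s>\deg P$. **Proposition 6.1.** Let $r$ be an integer with $0\le r\le q-1$. 1. If $(q,r)\ne(2,0)$, there exists a nonzero $P\in\mathbb F_q[\theta]$ such that the analytic rank of $\mathfrak C_P$ is exactly $r$. 2. If $r\ge1$, one such $P$ is the polynomial with $a_{i(q-1)-1}=-1$ for $i=1,\dots,r$ and all other coefficients $0$: it is nonzero, the analytic rank of $\mathfrak C_P$ is exactly $r$, and the matrix $\mathfrak M(P,r)$ is upper triangular with all diagonal entries equal to $1$. -/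

import Mathlib

open Polynomial

noncomputable section

universe u

namespace CarlitzTwist

/-- For an `𝔽_q`-algebra `R` (`F = 𝔽_q`), the ring endomorphism `∑ cᵢ Tⁱ ↦ ∑ cᵢ^q Tⁱ` of `R[T]`. -/
def coeffFrob (F : Type*) [Field F] [Fintype F] (R : Type*) [CommRing R] [Algebra F R] :
    R[X] →+* R[X] :=
  Polynomial.mapRingHom (FiniteField.frobeniusAlgHom F R : R →+* R)

/-- An Anderson T-motive over `𝔽_q(θ)` (`F = 𝔽_q`, `RatFunc F = 𝔽_q(θ)`): a module over
`𝔽_q(θ)[T]` (the variable of this polynomial ring is `T`), free of finite rank, with an additive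
operator `τ` satisfying `τ θ = θ^q τ`, `τ T = T τ`, free of finite rank over `𝔽_q(θ)[τ]`, and
such that a positive power of `T - θ` annihilates `M / τ M`. -/
structure AndersonTMotive (F : Type u) [Field F] [Fintype F] where
  /-- the underlying set -/
  carrier : Type u
  [addCommGroup : AddCommGroup carrier]
  [module : Module (RatFunc F)[X] carrier]
  [free : Module.Free (RatFunc F)[X] carrier]
  [finite : Module.Finite (RatFunc F)[X] carrier]
  /-- the action of `τ` -/
  τ : carrier →+ carrier
  τ_smul : ∀ (f : (RatFunc F)[X]) (m : carrier), τ (f • m) = coeffFrob F (RatFunc F) f • τ m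
  /-- there is a finite basis `e` over the skew polynomial ring `𝔽_q(θ)[τ]`: every element is
  uniquely of the form `∑ⱼ (∑ᵢ cⱼᵢ τⁱ) eⱼ` -/
  exists_basis_τ : ∃ (n : ℕ) (e : Fin n → carrier), ∀ m : carrier,
    ∃! c : Fin n → ℕ →₀ RatFunc F, m = ∑ j, (c j).sum fun i a => (C a : (RatFunc F)[X]) • (τ^[i] (e j))
  exists_pow_smul_mem : ∃ k : ℕ, 0 < k ∧ ∀ m : carrier,
    ((X - C RatFunc.X) ^ k : (RatFunc F)[X]) • m ∈ Submodule.span (RatFunc F)[X] (Set.range τ)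

attribute [instance] AndersonTMotive.addCommGroup AndersonTMotive.module AndersonTMotive.free
  AndersonTMotive.finite

section LSeries

variable {F : Type u} [Field F] [Fintype F]

/-- `A^{[k]} = A^{(k-1)} ⋯ A^{(1)} A`, where `A^{(i)}` is `A` with all coefficients of all entries
raised to the power `q^i`. -/
def frobProd {R : Type*} [CommRing R] [Algebra F R] {ι : Type*} [Fintype ι] [DecidableEq ι]
    (A : Matrix ι ι R[X]) : ℕ → Matrix ι ι R[X]
  | 0 => 1
  | k + 1 => A.map ((coeffFrob F R)^[k]) * frobProd A k

/-- The primes of `𝔽_q[θ]`, represented by monic irreducible polynomials in `θ`. -/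
abbrev FinitePrime (F : Type u) [Field F] : Type u := {p : F[X] // p.Monic ∧ Irreducible p}

/-- The residue ring `𝔽_q[θ]/𝔓`; `AdjoinRoot p` is by definition the quotient of `F[X]` by the ideal
generated by `p`. -/
abbrev Residue (p : F[X]) : Type u := AdjoinRoot p

/-- The reduction modulo `𝔓` of a matrix over `𝔽_q[θ][T]`. -/
def reduce {ι : Type*} (Q : Matrix ι ι F[X][X]) (p : F[X]) : Matrix ι ι (Residue p)[X] :=
  Q.map (Polynomial.map (AdjoinRoot.mk p))

/-- `det (I - A^{[d]} U^d)` as a polynomial in `U` over `R[T]`. -/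
def frobDet {R : Type*} [CommRing R] [Algebra F R] {ι : Type*} [Fintype ι] [DecidableEq ι]
    (A : Matrix ι ι R[X]) (d : ℕ) : R[X][X] :=
  (1 - (X ^ d : R[X][X]) • (frobProd (F := F) A d).map (C : R[X] → R[X][X])).det

theorem exists_algebraMap_of_pow_card {R : Type*} [CommRing R] [IsDomain R] [Algebra F R] (c : R)
    (hc : c ^ Fintype.card F = c) : ∃ a : F, algebraMap F R a = c := by
  have h : ∏ a : F, (X - C a) = (X ^ Fintype.card F - X : F[X]) := by
    have h1 : (X ^ Fintype.card F - X : F[X]).roots = Finset.univ.val :=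
      FiniteField.roots_X_pow_card_sub_X F
    have h2 : (X ^ Fintype.card F - X : F[X]).natDegree = Fintype.card F :=
      FiniteField.X_pow_card_sub_X_natDegree_eq F Fintype.one_lt_card
    have h3 : (X ^ Fintype.card F - X : F[X]).Monic :=
      monic_X_pow_sub (by rw [degree_X]; exact_mod_cast Fintype.one_lt_card)
    have := Polynomial.prod_multiset_X_sub_C_of_monic_of_roots_card_eq h3
      (by rw [h1, h2]; rfl)
    rw [h1] at this
    exact this
  have h' := congrArg (Polynomial.aeval c) h
  simp only [map_prod, map_sub, aeval_X, aeval_C, map_pow, hc, sub_self] at h'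
  obtain ⟨a, -, ha⟩ := Finset.prod_eq_zero_iff.mp h'
  exact ⟨a, (sub_eq_zero.mp ha).symm⟩

theorem frobProd_map_mul {R : Type*} [CommRing R] [Algebra F R] {ι : Type*} [Fintype ι]
    [DecidableEq ι] (A : Matrix ι ι R[X]) (k : ℕ) :
    (frobProd (F := F) A k).map (coeffFrob F R) * A = frobProd (F := F) A (k + 1) := by
  induction k with
  | zero => simp [frobProd, Matrix.map_one]
  | succ k ih =>
    rw [frobProd, Matrix.map_mul, Matrix.mul_assoc, ih, Matrix.map_map]
    conv_rhs => rw [frobProd]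
    rw [Function.iterate_succ']

theorem frobDet_map {R : Type*} [CommRing R] [Algebra F R] {ι : Type*} [Fintype ι]
    [DecidableEq ι] (A : Matrix ι ι R[X]) (d : ℕ) (hd : 0 < d)
    (hA : A.map ((coeffFrob F R)^[d]) = A) :
    (frobDet (F := F) A d).map (coeffFrob F R) = frobDet (F := F) A d := by
  obtain ⟨e, rfl⟩ : ∃ e, d = e + 1 := ⟨d - 1, by omega⟩
  set B := (frobProd (F := F) A e).map (coeffFrob F R) with hB
  have h1 : frobProd (F := F) A (e + 1) = B * A := (frobProd_map_mul A e).symm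
  have h2 : (frobProd (F := F) A (e + 1)).map (coeffFrob F R) = A * B := by
    rw [frobProd, Matrix.map_mul, Matrix.map_map, ← Function.iterate_succ', hA]
  have h3 : (frobDet (F := F) A (e + 1)).map (coeffFrob F R) =
      (1 - (X ^ (e + 1) : R[X][X]) • (A * B).map (C : R[X] → R[X][X])).det := by
    rw [frobDet, ← Polynomial.coe_mapRingHom, RingHom.map_det, ← h2]
    congr 1
    ext1 i j
    simp [Matrix.sub_apply, Matrix.one_apply, apply_ite]
  have hmul : ∀ M N : Matrix ι ι R[X], (X ^ (e + 1) : R[X][X]) • (M * N).map (C : R[X] → R[X][X]) =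
      ((X ^ (e + 1) : R[X][X]) • M.map (C : R[X] → R[X][X])) * N.map (C : R[X] → R[X][X]) := by
    intro M N
    rw [Matrix.map_mul, Matrix.smul_mul]
  rw [h3, frobDet, h1, hmul B A, hmul A B, Matrix.det_one_sub_mul_comm, Matrix.mul_smul,
    Matrix.smul_mul]

/-- For a prime `𝔓` of degree `d`, `det (I - Q̃^{[d]} U^d)` has coefficients in `𝔽_q`. -/
theorem exists_localDet {ι : Type*} [Fintype ι] [DecidableEq ι] (Q : Matrix ι ι F[X][X])
    (p : FinitePrime F) : ∃ D : F[X][X],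
      D.map (Polynomial.mapRingHom (algebraMap F (Residue p.1))) =
        frobDet (F := F) (reduce Q p.1) p.1.natDegree := by
  have hirr := p.2.2
  have : Fact (Irreducible p.1) := ⟨hirr⟩
  have hd : 0 < p.1.natDegree := hirr.natDegree_pos
  have hcard : ∀ c : Residue p.1, c ^ Fintype.card F ^ p.1.natDegree = c := by
    intro c
    have : Module.Finite F (Residue p.1) := p.2.1.finite_adjoinRoot
    have : Finite (Residue p.1) := Module.finite_of_finite F
    have : Fintype (Residue p.1) := Fintype.ofFinite _
    have h := Module.card_eq_pow_finrank (K := F) (V := Residue p.1)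
    rw [(AdjoinRoot.powerBasis hirr.ne_zero).finrank, AdjoinRoot.powerBasis_dim] at h
    rw [← h]
    exact FiniteField.pow_card c
  have hit : ∀ (n : ℕ) (f : (Residue p.1)[X]) (i : ℕ),
      (((coeffFrob F (Residue p.1))^[n]) f).coeff i = f.coeff i ^ Fintype.card F ^ n := by
    intro n f i
    induction n with
    | zero => simp
    | succ n ih =>
      rw [Function.iterate_succ_apply']
      have h1 : ∀ g : (Residue p.1)[X],
          (coeffFrob F (Residue p.1) g).coeff i = g.coeff i ^ Fintype.card F := fun g =>
        Polynomial.coeff_map _ _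
      rw [h1, ih, pow_succ, pow_mul]
  have hmap := frobDet_map (F := F) (reduce Q p.1) p.1.natDegree hd (by
    ext i j n
    rw [Matrix.map_apply, hit, hcard])
  have hmem : frobDet (F := F) (reduce Q p.1) p.1.natDegree ∈
      (Polynomial.mapRingHom (Polynomial.mapRingHom (algebraMap F (Residue p.1)))).range := by
    rw [Polynomial.mem_map_range]
    intro n
    rw [Polynomial.mem_map_range]
    intro m
    apply exists_algebraMap_of_pow_card
    have := congrArg (fun D => (D.coeff n).coeff m) hmap
    simpa [coeffFrob, Polynomial.coeff_map] using this
  exact hmem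

/-- `det (I - Q̃^{[d]} U^d)` for the prime `𝔓` of degree `d`, as an element of `𝔽_q[T][U]`. -/
def localDet {ι : Type*} [Fintype ι] [DecidableEq ι] (Q : Matrix ι ι F[X][X])
    (p : FinitePrime F) : F[X][X] :=
  (exists_localDet Q p).choose

theorem localDet_spec {ι : Type*} [Fintype ι] [DecidableEq ι] (Q : Matrix ι ι F[X][X])
    (p : FinitePrime F) :
    (localDet Q p).map (Polynomial.mapRingHom (algebraMap F (Residue p.1))) =
      frobDet (F := F) (reduce Q p.1) p.1.natDegree :=
  (exists_localDet Q p).choose_spec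

/-- The local factor `det (I - Q̃^{[d]} U^d)⁻¹ ∈ 𝔽_q[T][[U]]`. -/
def localFactor {ι : Type*} [Fintype ι] [DecidableEq ι] (Q : Matrix ι ι F[X][X])
    (p : FinitePrime F) : PowerSeries F[X] :=
  PowerSeries.invOfUnit (localDet Q p : PowerSeries F[X]) 1

theorem finite_primes_le (F : Type u) [Field F] [Fintype F] (N : ℕ) :
    {p : FinitePrime F | p.1.natDegree ≤ N}.Finite := by
  have h : Set.Finite (Polynomial.degreeLT F (N + 1) : Set F[X]) := by
    have : Finite (Polynomial.degreeLT F (N + 1)) :=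
      Finite.of_equiv _ (Polynomial.degreeLTEquiv F (N + 1)).symm.toEquiv
    exact Set.toFinite _
  refine Set.Finite.of_finite_image (f := Subtype.val) (h.subset ?_) Subtype.val_injective.injOn
  rintro _ ⟨p, hp, rfl⟩
  rw [SetLike.mem_coe, Polynomial.mem_degreeLT]
  refine lt_of_le_of_lt Polynomial.degree_le_natDegree ?_
  exact_mod_cast Nat.lt_succ_of_le hp

/-- The primes of degree at most `N`. -/
def primesLE (F : Type u) [Field F] [Fintype F] (N : ℕ) : Finset (FinitePrime F) :=
  (finite_primes_le F N).toFinset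

/-- The product of the local factors over all primes `𝔓` of `𝔽_q[θ]`, an element of `𝔽_q[T][[U]]`,
for a matrix integral at all primes. The local factor at `𝔓` is a power series in `U ^ deg 𝔓` with
constant term `1`, so the primes of degree at most `N` determine the coefficient of `U ^ N`
(see `coeff_prod_localFactor`). -/
def LSeries {ι : Type*} [Fintype ι] [DecidableEq ι] (Q : Matrix ι ι F[X][X]) : PowerSeries F[X] :=
  PowerSeries.mk fun N => PowerSeries.coeff N (∏ p ∈ primesLE F N, localFactor Q p)

theorem X_pow_dvd_frobDet {R : Type*} [CommRing R] [Algebra F R] {ι : Type*} [Fintype ι]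
    [DecidableEq ι] (A : Matrix ι ι R[X]) (d : ℕ) :
    (X ^ d : R[X][X]) ∣ frobDet (F := F) A d - 1 := by
  have key : ∀ (S : Type _) [CommRing S] (φ : R[X][X] →+* S), φ (X ^ d) = 0 →
      φ (frobDet (F := F) A d) = 1 := by
    intro S _ φ h0
    rw [frobDet, RingHom.map_det]
    refine Eq.trans (congrArg Matrix.det ?_) (Matrix.det_one (n := ι))
    ext1 i j
    rw [RingHom.mapMatrix_apply, Matrix.map_apply, Matrix.sub_apply, Matrix.smul_apply, smul_eq_mul,
      map_sub, map_mul, h0, zero_mul, sub_zero, Matrix.one_apply, Matrix.one_apply]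
    split_ifs <;> simp
  have h0 : Ideal.Quotient.mk (Ideal.span {(X ^ d : R[X][X])}) (X ^ d) = 0 :=
    Ideal.Quotient.eq_zero_iff_mem.mpr (Ideal.mem_span_singleton_self _)
  have h1 := key (R[X][X] ⧸ Ideal.span {(X ^ d : R[X][X])}) (Ideal.Quotient.mk _) h0
  rw [← Ideal.mem_span_singleton, ← Ideal.Quotient.eq, map_one]
  exact h1

theorem X_pow_dvd_localDet {ι : Type*} [Fintype ι] [DecidableEq ι] (Q : Matrix ι ι F[X][X])
    (p : FinitePrime F) : (X ^ p.1.natDegree : F[X][X]) ∣ localDet Q p - 1 := by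
  have hinj : Function.Injective (Polynomial.mapRingHom (algebraMap F (Residue p.1))) := by
    have : Fact (Irreducible p.1) := ⟨p.2.2⟩
    exact Polynomial.map_injective _ (algebraMap F (Residue p.1)).injective
  have h := X_pow_dvd_frobDet (F := F) (reduce Q p.1) p.1.natDegree
  rw [← localDet_spec] at h
  rw [Polynomial.X_pow_dvd_iff] at h ⊢
  intro d hd
  apply hinj
  have := h d hd
  rw [← Polynomial.map_one (Polynomial.mapRingHom (algebraMap F (Residue p.1))),
    ← Polynomial.map_sub, Polynomial.coeff_map] at this
  rw [this, map_zero]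

theorem X_pow_dvd_localFactor {ι : Type*} [Fintype ι] [DecidableEq ι] (Q : Matrix ι ι F[X][X])
    (p : FinitePrime F) : (PowerSeries.X ^ p.1.natDegree : PowerSeries F[X]) ∣
      localFactor Q p - 1 := by
  obtain ⟨c, hc⟩ := X_pow_dvd_localDet Q p
  have hc' : (localDet Q p : PowerSeries F[X]) =
      1 + PowerSeries.X ^ p.1.natDegree * (c : PowerSeries F[X]) := by
    have := congrArg (fun f : F[X][X] => (f : PowerSeries F[X])) (sub_eq_iff_eq_add'.mp hc)
    simpa using this
  have h0 : PowerSeries.constantCoeff (localDet Q p : PowerSeries F[X]) =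
      ((1 : F[X]ˣ) : F[X]) := by
    rw [hc']
    simp [p.2.2.natDegree_pos.ne']
  have hm : (localDet Q p : PowerSeries F[X]) * localFactor Q p = 1 :=
    PowerSeries.mul_invOfUnit _ _ h0
  refine ⟨-(c : PowerSeries F[X]) * localFactor Q p, ?_⟩
  rw [hc'] at hm
  linear_combination hm

/-- The Euler product converges to `LSeries Q`: in each degree the partial products stabilize. -/
theorem coeff_prod_localFactor {ι : Type*} [Fintype ι] [DecidableEq ι] (Q : Matrix ι ι F[X][X])
    (N : ℕ) (s : Finset (FinitePrime F)) (hs : primesLE F N ⊆ s) :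
    PowerSeries.coeff N (∏ p ∈ s, localFactor Q p) = PowerSeries.coeff N (LSeries Q) := by
  classical
  rw [LSeries, PowerSeries.coeff_mk, ← Finset.prod_sdiff hs]
  have h : (PowerSeries.X ^ (N + 1) : PowerSeries F[X]) ∣
      (∏ p ∈ s \ primesLE F N, localFactor Q p) - 1 := by
    rw [← Ideal.mem_span_singleton, ← Ideal.Quotient.eq, map_prod, map_one]
    refine Finset.prod_eq_one fun p hp => ?_
    rw [← map_one (Ideal.Quotient.mk _), Ideal.Quotient.eq, Ideal.mem_span_singleton]
    refine (pow_dvd_pow _ ?_).trans (X_pow_dvd_localFactor Q p)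
    by_contra hlt
    exact (Finset.mem_sdiff.mp hp).2
      ((Set.Finite.mem_toFinset _).mpr (show p.1.natDegree ≤ N by omega))
  obtain ⟨c, hc⟩ := h
  rw [sub_eq_iff_eq_add'.mp hc, add_mul, one_mul, map_add, mul_assoc,
    PowerSeries.coeff_X_pow_mul', if_neg (by omega), add_zero]

/-- `Q` is the matrix of multiplication by `τ` in the basis `b`, all of whose entries are integral
at all primes: `τ bᵢ = ∑ⱼ Qᵢⱼ bⱼ` with `Qᵢⱼ ∈ 𝔽_q[θ][T]`. -/
def IsIntegralMatrix (M : AndersonTMotive F) {ι : Type*} [Fintype ι]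
    (b : Module.Basis ι (RatFunc F)[X] M.carrier) (Q : Matrix ι ι F[X][X]) : Prop :=
  ∀ i, M.τ (b i) = ∑ j, (Q i j).map (algebraMap F[X] (RatFunc F)) • b j

/-- The model of `M` given by the basis `b` is integral at all primes, its `L`-series `L(M, U)` is a
polynomial in `U`, and this polynomial has a zero of order exactly `r` at `U = 1`. -/
def HasAnalyticRank (M : AndersonTMotive F) {ι : Type*} [Fintype ι] [DecidableEq ι]
    (b : Module.Basis ι (RatFunc F)[X] M.carrier) (r : ℕ) : Prop :=
  ∃ Q : Matrix ι ι F[X][X], IsIntegralMatrix M b Q ∧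
    ∃ f : F[X][X], (f : PowerSeries F[X]) = LSeries Q ∧ f ≠ 0 ∧ f.rootMultiplicity 1 = r

end LSeries

section Carlitz

variable {F : Type u} [Field F] [Fintype F]

/-- `P (T - θ)` in `𝔽_q(θ)[T]`, for `P ∈ 𝔽_q[θ]`. -/
def carlitzMultiplier (P : F[X]) : (RatFunc F)[X] :=
  C (algebraMap F[X] (RatFunc F) P) * (X - C RatFunc.X)

/-- The operator `τ (∑ cᵢ Tⁱ) = P (T - θ) ∑ cᵢ^q Tⁱ` on `𝔽_q(θ)[T]`. -/
def carlitzτ (P : F[X]) : (RatFunc F)[X] →+ (RatFunc F)[X] :=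
  (AddMonoidHom.mulLeft (carlitzMultiplier P)).comp (coeffFrob F (RatFunc F)).toAddMonoidHom

theorem carlitzτ_apply (P : F[X]) (x : (RatFunc F)[X]) :
    carlitzτ P x = carlitzMultiplier P * coeffFrob F (RatFunc F) x := rfl

theorem degree_iterate_carlitzτ (P : F[X]) (hP : P ≠ 0) (i : ℕ) :
    ((carlitzτ P)^[i] 1).degree = i := by
  induction i with
  | zero => simp
  | succ i ih =>
    have hP' : algebraMap F[X] (RatFunc F) P ≠ 0 := by
      simpa using hP
    rw [Function.iterate_succ_apply', carlitzτ_apply, degree_mul, carlitzMultiplier, degree_C_mul hP',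
      degree_X_sub_C, coeffFrob, Polynomial.coe_mapRingHom, degree_map, ih]
    push_cast
    rw [add_comm]

/-- The twisted Carlitz module `ℭ_P`, `P ≠ 0`: as a `𝔽_q(θ)[T]`-module it is `𝔽_q(θ)[T] e` with
`e = 1`, and it has the basis `e` over `𝔽_q(θ)[τ]`, with `T e = θ e + P⁻¹ τ e`
(see `twistedCarlitz_X_smul`). -/
def twistedCarlitz (P : F[X]) (hP : P ≠ 0) : AndersonTMotive F where
  carrier := (RatFunc F)[X]
  τ := carlitzτ P
  τ_smul f m := by
    rw [carlitzτ_apply, carlitzτ_apply, smul_eq_mul, smul_eq_mul, map_mul]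
    ring
  exists_basis_τ := by
    let S : Polynomial.Sequence (RatFunc F) :=
      ⟨fun i => (carlitzτ P)^[i] 1, degree_iterate_carlitzτ P hP⟩
    have hS : ∀ i, IsUnit (S i).leadingCoeff := fun i =>
      (leadingCoeff_ne_zero.mpr (S.ne_zero i)).isUnit
    let B := S.basis hS
    have hB : ∀ c : ℕ →₀ RatFunc F,
        (c.sum fun i a => (C a : (RatFunc F)[X]) • ((carlitzτ P)^[i] 1)) = B.repr.symm c := by
      intro c
      rw [Module.Basis.repr_symm_apply, Finsupp.linearCombination_apply]
      refine Finsupp.sum_congr fun i _ => ?_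
      rw [Polynomial.Sequence.basis_eq_self, smul_eq_mul, ← Polynomial.smul_eq_C_mul]
    refine ⟨1, fun _ => 1, fun m => ⟨fun _ => B.repr m, ?_, ?_⟩⟩
    · show m = _
      rw [Fin.sum_univ_one, hB, LinearEquiv.symm_apply_apply]
    · intro c hc
      funext j
      have hc' : m = _ := hc
      rw [Fin.sum_univ_one, hB] at hc'
      rw [hc', LinearEquiv.apply_symm_apply, Subsingleton.elim j 0]
  exists_pow_smul_mem := by
    refine ⟨1, one_pos, fun m => ?_⟩
    have hP' : algebraMap F[X] (RatFunc F) P ≠ 0 := by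
      simpa using hP
    have h : ((X - C RatFunc.X) ^ 1 : (RatFunc F)[X]) • m =
        (m * C (algebraMap F[X] (RatFunc F) P)⁻¹) • carlitzτ P 1 := by
      have h1 : (C (algebraMap F[X] (RatFunc F) P)⁻¹ : (RatFunc F)[X]) *
          C (algebraMap F[X] (RatFunc F) P) = 1 := by
        rw [← C_mul, inv_mul_cancel₀ hP', C_1]
      rw [carlitzτ_apply, map_one, mul_one, carlitzMultiplier, smul_eq_mul, smul_eq_mul, pow_one]
      linear_combination (-(X - C RatFunc.X) * m) * h1
    rw [h]
    exact Submodule.smul_mem _ _ (Submodule.subset_span ⟨1, rfl⟩)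

/-- The basis `{e}`, `e = 1`, of `ℭ_P` over `𝔽_q(θ)[T]`. -/
def carlitzBasis (P : F[X]) (hP : P ≠ 0) :
    Module.Basis (Fin 1) (RatFunc F)[X] (twistedCarlitz P hP).carrier :=
  Module.Basis.singleton (Fin 1) (RatFunc F)[X]

/-- `T e = θ e + P⁻¹ τ e` in `ℭ_P`. -/
theorem twistedCarlitz_X_smul (P : F[X]) (hP : P ≠ 0) :
    (X : (RatFunc F)[X]) • carlitzBasis P hP 0 =
      (C RatFunc.X : (RatFunc F)[X]) • carlitzBasis P hP 0 +
      (C (algebraMap F[X] (RatFunc F) P)⁻¹ : (RatFunc F)[X]) •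
        (twistedCarlitz P hP).τ (carlitzBasis P hP 0) := by
  have hP' : algebraMap F[X] (RatFunc F) P ≠ 0 := by
    simpa using hP
  have h1 : (C (algebraMap F[X] (RatFunc F) P)⁻¹ : (RatFunc F)[X]) *
      C (algebraMap F[X] (RatFunc F) P) = 1 := by
    rw [← C_mul, inv_mul_cancel₀ hP', C_1]
  have he : carlitzBasis P hP 0 = (1 : (RatFunc F)[X]) :=
    Module.Basis.singleton_apply (Fin 1) (RatFunc F)[X] 0
  rw [he]
  show (X * 1 : (RatFunc F)[X]) = (C RatFunc.X * 1 : (RatFunc F)[X]) +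
    (C (algebraMap F[X] (RatFunc F) P)⁻¹ * carlitzτ P 1 : (RatFunc F)[X])
  rw [carlitzτ_apply, map_one, carlitzMultiplier]
  linear_combination (-(X - C RatFunc.X)) * h1

/-- The matrix of `τ` on `ℭ_P` consists of the one element `P (T - θ)`. -/
theorem twistedCarlitz_isIntegralMatrix (P : F[X]) (hP : P ≠ 0) :
    IsIntegralMatrix (twistedCarlitz P hP) (carlitzBasis P hP) (fun _ _ => C P * (X - C X)) := by
  intro i
  have he : ∀ i, carlitzBasis P hP i = (1 : (RatFunc F)[X]) :=
    Module.Basis.singleton_apply (Fin 1) (RatFunc F)[X]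
  rw [Fin.sum_univ_one, he, he]
  show carlitzτ P 1 = ((C P * (X - C X) : F[X][X]).map (algebraMap F[X] (RatFunc F))) * 1
  rw [carlitzτ_apply, map_one, carlitzMultiplier]
  simp

/-- The coefficient `a_z` of `θ^z` in `P`, for `z ∈ ℤ`; it is `0` for `z < 0`. -/
def intCoeff (P : F[X]) (z : ℤ) : F := if 0 ≤ z then P.coeff z.toNat else 0

/-- The `k × k` matrix over `𝔽_q[T]` whose entry in row `i` and column `j` (`1 ≤ i, j ≤ k`) is
`a_{iq-j} T - a_{iq-j-1}`. -/
def carlitzMatrix (P : F[X]) (k : ℕ) : Matrix (Fin k) (Fin k) F[X] := fun i j =>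
  C (intCoeff P (((i : ℤ) + 1) * Fintype.card F - ((j : ℤ) + 1))) * X -
    C (intCoeff P (((i : ℤ) + 1) * Fintype.card F - ((j : ℤ) + 1) - 1))

/-- The polynomial `P = ∑ aᵢ θⁱ` with `a_{i(q-1)-1} = -1` for `i = 1, …, r` and all other
coefficients `0`. -/
def examplePoly (F : Type u) [Field F] [Fintype F] (r : ℕ) : F[X] :=
  ∑ i ∈ Finset.Icc 1 r, C (-1) * X ^ (i * (Fintype.card F - 1) - 1)

end Carlitz

end CarlitzTwist

end

/-!
The `L`-series is `∑_f ∏_α Q(α) U^(deg f)`, where `f` runs over the monic polynomials, `α` over the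
roots of `f`, and `Q = P(θ) (T - θ)` (`map_coeff_LSeries`, `map_localDet_fin_one`). The product
over the roots is a polynomial `G` in the elementary symmetric functions `e₁, …, eₙ` of the roots,
so that the coefficient of `Uⁿ` is the sum of `G` over `𝔽_qⁿ`. As `∑ cᵏ` over `c ∈ 𝔽_q` is `-1` or
`0` according to whether `k` is a positive multiple of `q - 1`, this sum is `(-1)ⁿ` times the trace
of the operator `g ↦ ψ(G g)` on polynomials in `e₁, …, eₙ`, where `ψ` is the Cartier operator
`e^(q (b + 1) - 1) ↦ e^b`.

The Cartier operator, which acts on differential forms of top degree, does not depend on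
the coordinates, and `de₁ ⋯ deₙ = Δ dx₁ ⋯ dxₙ` with the Vandermonde determinant `Δ`. Hence the
operator becomes `ψ(Q(x₁) ⋯ Q(xₙ) ·)` on the alternating polynomials in `x₁, …, xₙ`
(`cartier_alternant_mul_esymmSubst`), which is the `n`-th exterior power of the operator `ψ(Q ·)` on
polynomials in `θ`. The matrix of the latter has the entries `a_{iq-j} T - a_{iq-j-1}`, so this is
the formula `L(ℭ_P, U) = det(1 - 𝔐(P) U)`.

Only triangular matrices are needed here. For these the trace is read off in the
basis of monomials in `e₁, …, eₙ`, comparing lexicographically leading terms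
(`coeff_of_esymmSubst_eq_prod`): the diagonal entries of the exterior power are products of diagonal
entries of the matrix. For the example polynomial the matrix is upper triangular with diagonal
entries `1` (`r` times) and then `0`, so `L(ℭ_P, U) = (1 - U)^r` (`hasAnalyticRank_of_triangular`).
For `r = 0` and `q > 2` the same holds for `P = 1`, all diagonal entries being `0`.
-/

noncomputable section

universe u

/-! ### The Cartier operator and alternating polynomials -/

namespace MvPolynomial

section Cartier

open Finset

variable {n : ℕ} {B : Type*} [CommRing B]

/-- The exponent `q (b + 1) - 1` in each variable. -/
def cartierExp (q : ℕ) (b : Fin n →₀ ℕ) : Fin n →₀ ℕ :=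
  Finsupp.equivFunOnFinite.symm fun i => q * (b i + 1) - 1

@[simp]
theorem cartierExp_apply (q : ℕ) (b : Fin n →₀ ℕ) (i : Fin n) :
    cartierExp q b i = q * (b i + 1) - 1 := rfl

theorem cartierExp_injective (q : ℕ) [NeZero q] :
    Function.Injective (cartierExp q : (Fin n →₀ ℕ) → _) := by
  intro a b h
  ext i
  have hi := DFunLike.congr_fun h i
  have hq : 0 < q := Nat.pos_of_neZero q
  simp only [cartierExp_apply] at hi
  have h1 : 0 < q * (a i + 1) := by positivity
  have h2 : 0 < q * (b i + 1) := by positivity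
  have h3 : q * (a i + 1) = q * (b i + 1) := by omega
  exact Nat.succ_injective (Nat.eq_of_mul_eq_mul_left hq h3)

theorem cartierExp_mapDomain (q : ℕ) (σ : Equiv.Perm (Fin n)) (b : Fin n →₀ ℕ) :
    cartierExp q (b.mapDomain σ) = (cartierExp q b).mapDomain σ := by
  ext i
  simp [Finsupp.mapDomain_equiv_apply]

theorem cartierExp_lex_lt (q : ℕ) [NeZero q] {a b : Fin n →₀ ℕ} (h : toLex a < toLex b) :
    toLex (cartierExp q a) < toLex (cartierExp q b) := by
  have hq : 0 < q := Nat.pos_of_neZero q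
  obtain ⟨i, hi, hlt⟩ := Finsupp.Lex.lt_iff.mp h
  refine Finsupp.Lex.lt_iff.mpr ⟨i, fun j hj => ?_, ?_⟩
  · have : a j = b j := hi j hj
    simp [this]
  · have h1 : a i < b i := hlt
    have h2 : q * (a i + 1) < q * (b i + 1) := Nat.mul_lt_mul_of_pos_left (by omega) hq
    have h3 : 0 < q * (a i + 1) := by positivity
    simp only [ofLex_toLex, cartierExp_apply]
    omega

/-- The Cartier operator `x ^ (q (b + 1) - 1) ↦ x ^ b` on `B[x₁, …, xₙ]`; monomials of any other
shape are sent to `0`. -/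
def cartier (q : ℕ) [NeZero q] (p : MvPolynomial (Fin n) B) : MvPolynomial (Fin n) B :=
  ∑ b ∈ p.support.preimage (cartierExp q) (cartierExp_injective q).injOn,
    monomial b (coeff (cartierExp q b) p)

@[simp]
theorem coeff_cartier (q : ℕ) [NeZero q] (p : MvPolynomial (Fin n) B) (b : Fin n →₀ ℕ) :
    coeff b (cartier q p) = coeff (cartierExp q b) p := by
  classical
  simp only [cartier, coeff_sum, coeff_monomial, Finset.sum_ite_eq', mem_preimage,
    MvPolynomial.mem_support_iff]
  split_ifs with h
  · rfl
  · exact (not_not.mp h).symm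

theorem cartier_add (q : ℕ) [NeZero q] (p p' : MvPolynomial (Fin n) B) :
    cartier q (p + p') = cartier q p + cartier q p' := by
  ext b; simp

theorem cartier_C_mul (q : ℕ) [NeZero q] (c : B) (p : MvPolynomial (Fin n) B) :
    cartier q (C c * p) = C c * cartier q p := by
  ext b; simp [coeff_C_mul]

theorem cartier_expand_mul (q : ℕ) [NeZero q] (p h : MvPolynomial (Fin n) B) :
    cartier q (expand q p * h) = p * cartier q h := by
  classical
  have hq : 0 < q := Nat.pos_of_neZero q
  induction p using MvPolynomial.induction_on' with
  | add p p' hp hp' => rw [map_add, add_mul, cartier_add, hp, hp', add_mul]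
  | monomial c r =>
    ext b
    rw [expand_monomial, coeff_cartier, coeff_monomial_mul', coeff_monomial_mul', coeff_cartier]
    have hle : q • c ≤ cartierExp q b ↔ c ≤ b := by
      refine forall_congr' fun i => ?_
      have h3 : 0 < q * (b i + 1) := by positivity
      simp only [Finsupp.smul_apply, smul_eq_mul, cartierExp_apply]
      rw [Nat.le_sub_one_iff_lt h3, Nat.mul_lt_mul_left hq, Nat.lt_succ_iff]
    simp only [hle]
    split_ifs with hcb
    · congr 2
      ext i
      have h1 : c i ≤ b i := hcb i
      obtain ⟨d, hd⟩ := Nat.exists_eq_add_of_le h1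
      simp only [Finsupp.tsub_apply, Finsupp.smul_apply, smul_eq_mul, cartierExp_apply, hd]
      rw [Nat.add_sub_cancel_left, add_assoc, mul_add]
      have h3 : 0 < q * (d + 1) := by positivity
      omega
    · rfl

/-- An alternating polynomial, expressed by its coefficients: transposing two exponents changes the
sign, and the coefficient vanishes if two exponents agree (a separate condition in
characteristic `2`). -/
def IsAlternating (p : MvPolynomial (Fin n) B) : Prop :=
  ∀ i j, i ≠ j → ∀ a : Fin n →₀ ℕ,
    coeff (a.mapDomain (Equiv.swap i j)) p = -coeff a p ∧ (a i = a j → coeff a p = 0)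

theorem mapDomain_swap_swap (i j : Fin n) (a : Fin n →₀ ℕ) :
    (a.mapDomain (Equiv.swap i j)).mapDomain (Equiv.swap i j) = a := by
  ext k
  simp [Finsupp.mapDomain_equiv_apply]

theorem coeff_mapDomain_of_isSymmetric {s : MvPolynomial (Fin n) B} (hs : s.IsSymmetric)
    (σ : Equiv.Perm (Fin n)) (a : Fin n →₀ ℕ) : coeff (a.mapDomain σ) s = coeff a s := by
  conv_lhs => rw [← hs σ]
  exact coeff_rename_mapDomain _ σ.injective _ _

theorem IsAlternating.mul_isSymmetric {p s : MvPolynomial (Fin n) B} (hp : IsAlternating p)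
    (hs : s.IsSymmetric) : IsAlternating (p * s) := by
  classical
  intro i j hij a
  constructor
  · rw [coeff_mul, coeff_mul, ← sum_neg_distrib]
    symm
    refine sum_nbij' (fun x => (x.1.mapDomain (Equiv.swap i j), x.2.mapDomain (Equiv.swap i j)))
      (fun x => (x.1.mapDomain (Equiv.swap i j), x.2.mapDomain (Equiv.swap i j))) ?_ ?_ ?_ ?_ ?_
    · intro x hx
      rw [HasAntidiagonal.mem_antidiagonal] at hx ⊢
      rw [← hx, Finsupp.mapDomain_add]
    · intro x hx
      rw [HasAntidiagonal.mem_antidiagonal] at hx ⊢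
      rw [← Finsupp.mapDomain_add, hx, mapDomain_swap_swap]
    · intro x _
      simp only [mapDomain_swap_swap]
    · intro x _
      simp only [mapDomain_swap_swap]
    · intro x _
      simp only [(hp i j hij x.1).1, coeff_mapDomain_of_isSymmetric hs, neg_mul]
  · intro ha
    have hfix : a.mapDomain (Equiv.swap i j) = a := by
      ext k
      rw [Finsupp.mapDomain_equiv_apply, Equiv.symm_swap]
      rcases eq_or_ne k i with rfl | hki
      · rw [Equiv.swap_apply_left, ha]
      rcases eq_or_ne k j with rfl | hkj
      · rw [Equiv.swap_apply_right, ha]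
      rw [Equiv.swap_apply_of_ne_of_ne hki hkj]
    rw [coeff_mul]
    refine sum_involution
      (fun x _ => (x.1.mapDomain (Equiv.swap i j), x.2.mapDomain (Equiv.swap i j))) ?_ ?_ ?_ ?_
    · intro x _
      simp only [(hp i j hij x.1).1, coeff_mapDomain_of_isSymmetric hs, neg_mul, add_neg_cancel]
    · intro x _ hx he
      apply hx
      have h1 : x.1.mapDomain (Equiv.swap i j) = x.1 := congrArg Prod.fst he
      have h2 : x.1 i = x.1 j := by
        conv_lhs => rw [← h1, Finsupp.mapDomain_equiv_apply, Equiv.symm_swap, Equiv.swap_apply_left]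
      rw [(hp i j hij x.1).2 h2, zero_mul]
    · intro x hx
      rw [HasAntidiagonal.mem_antidiagonal] at hx ⊢
      rw [← Finsupp.mapDomain_add, hx, hfix]
    · intro x _
      simp only [mapDomain_swap_swap]

theorem IsAlternating.sub {p p' : MvPolynomial (Fin n) B} (hp : IsAlternating p)
    (hp' : IsAlternating p') : IsAlternating (p - p') := by
  intro i j hij a
  refine ⟨?_, fun ha => ?_⟩
  · rw [coeff_sub, coeff_sub, (hp i j hij a).1, (hp' i j hij a).1]; ring
  · rw [coeff_sub, (hp i j hij a).2 ha, (hp' i j hij a).2 ha, sub_zero]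

theorem IsAlternating.cartier {p : MvPolynomial (Fin n) B} (hp : IsAlternating p)
    (q : ℕ) [NeZero q] : IsAlternating (cartier q p) := by
  intro i j hij a
  rw [coeff_cartier, coeff_cartier, cartierExp_mapDomain]
  refine ⟨(hp i j hij _).1, fun ha => (hp i j hij _).2 ?_⟩
  simp [ha]

/-- The exponent `(n - 1, …, 1, 0)`. -/
def staircase (n : ℕ) : Fin n →₀ ℕ := Finsupp.equivFunOnFinite.symm fun i => n - 1 - i

@[simp]
theorem staircase_apply (i : Fin n) : staircase n i = n - 1 - i := rfl

theorem staircase_injective : Function.Injective (staircase n) := by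
  intro i j h
  simp only [staircase_apply] at h
  ext
  omega

/-- In an alternating polynomial only strictly decreasing exponents can be leading exponents, and
the staircase is the least of these. -/
theorem IsAlternating.eq_zero {p : MvPolynomial (Fin n) B} (hp : IsAlternating p)
    (h : ∀ b, coeff b p ≠ 0 → toLex b < toLex (staircase n)) : p = 0 := by
  classical
  by_contra hne
  obtain ⟨b, hb, hmax⟩ := exists_max_image p.support toLex (support_nonempty.mpr hne)
  rw [MvPolynomial.mem_support_iff] at hb
  have hanti : ∀ i j, i < j → b j < b i := by
    intro i j hij
    by_contra hcon
    rcases eq_or_lt_of_le (not_lt.mp hcon) with heq | hlt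
    · exact hb ((hp i j hij.ne b).2 heq)
    · have h1 : b.mapDomain (Equiv.swap i j) ∈ p.support := by
        rw [MvPolynomial.mem_support_iff, (hp i j hij.ne b).1]
        exact neg_ne_zero.mpr hb
      refine (hmax _ h1).not_gt (Finsupp.Lex.lt_iff.mpr ⟨i, fun k hk => ?_, ?_⟩)
      · simp only [ofLex_toLex, Finsupp.mapDomain_equiv_apply, Equiv.symm_swap]
        rw [Equiv.swap_apply_of_ne_of_ne hk.ne (hk.trans hij).ne]
      · simp only [ofLex_toLex, Finsupp.mapDomain_equiv_apply, Equiv.symm_swap,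
          Equiv.swap_apply_left]
        exact hlt
  have hle : ∀ k : ℕ, ∀ i : Fin n, n - 1 - i = k → k ≤ b i := by
    intro k
    induction k with
    | zero => intro i _; exact Nat.zero_le _
    | succ k ih =>
      intro i hi
      have h1 : (i : ℕ) + 1 < n := by omega
      have h2 := ih ⟨i + 1, h1⟩ (by simp only; omega)
      have h3 := hanti i ⟨i + 1, h1⟩ (Fin.lt_def.mpr (by simp))
      omega
  have : staircase n ≤ b := fun i => hle _ i rfl
  exact (h b hb).not_ge (Finsupp.toLex_monotone this)

/-- The alternant `∑_σ sign(σ) x^{σ δ}`, `δ = (n - 1, …, 0)`, that is, the Vandermonde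
determinant. -/
def alternant (n : ℕ) (B : Type*) [CommRing B] : MvPolynomial (Fin n) B :=
  ∑ σ : Equiv.Perm (Fin n), monomial ((staircase n).mapDomain σ) ((Equiv.Perm.sign σ : ℤ) : B)

theorem mapDomain_staircase_injective :
    Function.Injective fun σ : Equiv.Perm (Fin n) => (staircase n).mapDomain σ := by
  intro σ σ' h
  have : σ.symm = σ'.symm := by
    ext1 i
    have := DFunLike.congr_fun h i
    simp only [Finsupp.mapDomain_equiv_apply] at this
    exact staircase_injective this
  exact Equiv.symm_bijective.injective this

theorem isAlternating_alternant : IsAlternating (alternant n B) := by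
  classical
  intro i j hij a
  simp only [alternant, coeff_sum, coeff_monomial]
  constructor
  · rw [← sum_neg_distrib]
    refine Fintype.sum_equiv (Equiv.mulLeft (Equiv.swap i j)) _ _ fun σ => ?_
    have : (staircase n).mapDomain σ = a.mapDomain (Equiv.swap i j) ↔
        (staircase n).mapDomain (Equiv.swap i j * σ : Equiv.Perm (Fin n)) = a := by
      rw [Equiv.Perm.coe_mul, Finsupp.mapDomain_comp]
      constructor
      · intro h
        rw [h, mapDomain_swap_swap]
      · intro h
        rw [← h, mapDomain_swap_swap]
    simp only [this, Equiv.coe_mulLeft, Equiv.Perm.sign_mul, Equiv.Perm.sign_swap hij]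
    split_ifs <;> simp
  · intro ha
    refine sum_eq_zero fun σ _ => if_neg ?_
    rintro rfl
    simp only [Finsupp.mapDomain_equiv_apply] at ha
    exact hij (σ.symm.injective (staircase_injective ha))

/-- The polynomial `p` is monic with leading exponent `a` for the lexicographic order. -/
def LeadsAt (p : MvPolynomial (Fin n) B) (a : Fin n →₀ ℕ) : Prop :=
  coeff a p = 1 ∧ ∀ b, toLex a < toLex b → coeff b p = 0

theorem LeadsAt.mul {p p' : MvPolynomial (Fin n) B} {a a' : Fin n →₀ ℕ} (h : LeadsAt p a)
    (h' : LeadsAt p' a') : LeadsAt (p * p') (a + a') := by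
  classical
  have key : ∀ x : (Fin n →₀ ℕ) × (Fin n →₀ ℕ), toLex a + toLex a' ≤ toLex x.1 + toLex x.2 →
      x ≠ (a, a') → coeff x.1 p * coeff x.2 p' = 0 := by
    intro x hx hne
    rcases lt_or_ge (toLex a) (toLex x.1) with h1 | h1
    · rw [h.2 _ h1, zero_mul]
    rcases lt_or_ge (toLex a') (toLex x.2) with h2 | h2
    · rw [h'.2 _ h2, mul_zero]
    exfalso
    apply hne
    rcases lt_or_eq_of_le h1 with h3 | h3
    · exact absurd hx (not_le.mpr (add_lt_add_of_lt_of_le h3 h2))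
    rcases lt_or_eq_of_le h2 with h4 | h4
    · exact absurd hx (not_le.mpr (add_lt_add_of_le_of_lt h1 h4))
    exact Prod.ext (toLex.injective h3) (toLex.injective h4)
  constructor
  · rw [coeff_mul, sum_eq_single (a, a')]
    · rw [h.1, h'.1, one_mul]
    · intro x hx hne
      rw [HasAntidiagonal.mem_antidiagonal] at hx
      exact key x (by rw [← toLex_add, ← toLex_add, hx]) hne
    · intro hx
      exact absurd (HasAntidiagonal.mem_antidiagonal.mpr (rfl : (a, a').1 + (a, a').2 = a + a')) hx
  · intro b hb
    rw [coeff_mul]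
    refine sum_eq_zero fun x hx => ?_
    rw [HasAntidiagonal.mem_antidiagonal] at hx
    refine key x (by rw [← toLex_add, ← toLex_add, hx]; exact hb.le) ?_
    rintro rfl
    rw [← hx] at hb
    exact lt_irrefl _ hb

theorem leadsAt_alternant : LeadsAt (alternant n B) (staircase n) := by
  classical
  constructor
  · simp only [alternant, coeff_sum, coeff_monomial]
    rw [sum_eq_single 1]
    · simp [Finsupp.mapDomain_id]
    · intro σ _ hσ
      refine if_neg fun h => hσ (mapDomain_staircase_injective ?_)
      simp only [h, Equiv.Perm.coe_one, Finsupp.mapDomain_id]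
    · simp
  · intro b hb
    simp only [alternant, coeff_sum, coeff_monomial]
    refine sum_eq_zero fun σ _ => if_neg ?_
    rintro rfl
    obtain ⟨i, hi, hlt⟩ := Finsupp.Lex.lt_iff.mp hb
    simp only [ofLex_toLex, Finsupp.mapDomain_equiv_apply] at hi hlt
    have h1 : σ.symm i < i := by
      simp only [staircase_apply] at hlt
      rw [Fin.lt_def]
      omega
    have h2 := staircase_injective (hi _ h1)
    exact h1.ne (σ.symm.injective h2.symm)

/-- The substitution of the elementary symmetric polynomials `e₁, …, eₙ` for the variables. -/
def esymmSubst (n : ℕ) (B : Type*) [CommRing B] :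
    MvPolynomial (Fin n) B →ₐ[B] MvPolynomial (Fin n) B :=
  aeval fun i : Fin n => esymm (Fin n) B (i + 1)

theorem isSymmetric_esymmSubst (p : MvPolynomial (Fin n) B) : (esymmSubst n B p).IsSymmetric := by
  rw [esymmSubst, ← esymmAlgHom_apply]
  exact (esymmAlgHom (Fin n) B n p).2

/-- The lexicographically leading exponent of `e₁^{t₁} ⋯ eₙ^{tₙ}`. -/
def esymmExp (t : Fin n →₀ ℕ) : Fin n →₀ ℕ :=
  Finsupp.equivFunOnFinite.symm (Fin.accumulate n n t)

theorem esymmExp_apply (t : Fin n →₀ ℕ) (j : Fin n) :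
    esymmExp t j = ∑ i : Fin n with j.val ≤ i.val, t i := rfl

theorem esymmExp_injective : Function.Injective (esymmExp : (Fin n →₀ ℕ) → _) := fun _ _ h =>
  DFunLike.ext' (Fin.accumulate_injective le_rfl (Finsupp.equivFunOnFinite.symm.injective h))

theorem leadsAt_esymmSubst_monomial [Nontrivial B] (t : Fin n →₀ ℕ) :
    LeadsAt (esymmSubst n B (monomial t 1)) (esymmExp t) := by
  have h0 : esymmSubst n B (monomial t 1) = esymmAlgHomMonomial (Fin n) t 1 := by
    rw [esymmAlgHomMonomial, esymmAlgHom_apply]; rfl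
  have h1 : AddMonoidAlgebra.supDegree toLex (esymmAlgHomMonomial (Fin n) t (1 : B)) =
      toLex (esymmExp t) := by
    have := supDegree_esymmAlgHomMonomial (one_ne_zero (α := B)) t (le_refl n)
    rw [← ofLex_inj]
    exact DFunLike.ext' this
  rw [h0]
  constructor
  · have h2 := leadingCoeff_esymmAlgHomMonomial (r := (1 : B)) t (le_refl n)
    rw [leadingCoeff_toLex, h1] at h2
    exact h2
  · intro b hb
    rw [← h1] at hb
    exact AddMonoidAlgebra.coeff_eq_zero_of_not_le_supDegree hb.not_ge

theorem esymmExp_mono {s t : Fin n →₀ ℕ} (h : s ≤ t) : esymmExp s ≤ esymmExp t := fun j => by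
  rw [esymmExp_apply, esymmExp_apply]
  exact sum_le_sum fun i _ => h i

end Cartier

end MvPolynomial

/-! ### Independence of coordinates of the Cartier operator -/

namespace MvPolynomial

section CartierEsymm

open Finset

variable {n : ℕ} {B : Type*} [CommRing B]

theorem LeadsAt.lex_le {p : MvPolynomial (Fin n) B} {a b : Fin n →₀ ℕ} (h : LeadsAt p a)
    (hb : coeff b p ≠ 0) : toLex b ≤ toLex a :=
  not_lt.mp fun hlt => hb (h.2 b hlt)

theorem leadsAt_alternant_mul [Nontrivial B] (t : Fin n →₀ ℕ) :
    LeadsAt (alternant n B * esymmSubst n B (monomial t 1)) (staircase n + esymmExp t) :=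
  leadsAt_alternant.mul (leadsAt_esymmSubst_monomial t)

theorem isAlternating_alternant_mul (h : MvPolynomial (Fin n) B) :
    IsAlternating (alternant n B * esymmSubst n B h) :=
  isAlternating_alternant.mul_isSymmetric (isSymmetric_esymmSubst h)

/-- The exponent all of whose entries are `q - 1`. -/
def constExp (n q : ℕ) : Fin n →₀ ℕ := Finsupp.equivFunOnFinite.symm fun _ => q - 1

@[simp]
theorem constExp_apply (q : ℕ) (i : Fin n) : constExp n q i = q - 1 := rfl

/-- The leading exponent of `Δ (e₁ ⋯ eₙ)^(q - 1)` is the one that the Cartier operator sends to the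
leading exponent of `Δ`. -/
theorem staircase_add_esymmExp_constExp (q : ℕ) [NeZero q] :
    staircase n + esymmExp (constExp n q) = cartierExp q (staircase n) := by
  have hq : 0 < q := Nat.pos_of_neZero q
  ext i
  have h1 : #{j : Fin n | i.val ≤ j.val} = n - i := by
    rw [← Fin.card_Ici i]
    have h0 : ({j : Fin n | i.val ≤ j.val} : Finset (Fin n)) = Ici i := by
      ext j
      rw [Finset.mem_filter_univ, Finset.mem_Ici, Fin.le_def]
    rw [h0]
  have hi := i.2
  simp only [Finsupp.add_apply, esymmExp_apply, constExp_apply, sum_const, h1, staircase_apply,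
    cartierExp_apply, smul_eq_mul]
  obtain ⟨k, hk⟩ : ∃ k, n - i = k + 1 := ⟨n - i - 1, by omega⟩
  obtain ⟨s, rfl⟩ : ∃ s, q = s + 1 := ⟨q - 1, by omega⟩
  have h2 : n - 1 - (i : ℕ) = k := by omega
  rw [hk, h2, Nat.add_sub_cancel]
  have : (s + 1) * (k + 1) = k + (k + 1) * s + 1 := by ring
  omega

theorem lex_le_staircase_of_coeff_cartier [Nontrivial B] (q : ℕ) [NeZero q] {t b : Fin n →₀ ℕ}
    (hb : coeff b (cartier q (alternant n B * esymmSubst n B (monomial t 1))) ≠ 0)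
    (ht : ∀ i, t i < q) : toLex b ≤ toLex (staircase n) ∧
      (t ≠ constExp n q → toLex b < toLex (staircase n)) := by
  rw [coeff_cartier] at hb
  have h1 := (leadsAt_alternant_mul t).lex_le hb
  have ht' : t ≤ constExp n q := fun i => by
    have := ht i
    simp only [constExp_apply]
    omega
  have h2 : staircase n + esymmExp t ≤ cartierExp q (staircase n) := by
    rw [← staircase_add_esymmExp_constExp]
    exact add_le_add_right (esymmExp_mono ht') _
  have h3 : toLex b ≤ toLex (staircase n) := by
    by_contra hcon
    exact (cartierExp_lex_lt q (not_le.mp hcon)).not_ge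
      (h1.trans (Finsupp.toLex_monotone h2))
  refine ⟨h3, fun hne => lt_of_le_of_ne h3 fun heq => hne ?_⟩
  have hbs : b = staircase n := toLex.injective heq
  rw [hbs] at h1
  have h4 : cartierExp q (staircase n) = staircase n + esymmExp t :=
    toLex.injective (le_antisymm h1 (Finsupp.toLex_monotone h2))
  rw [← staircase_add_esymmExp_constExp] at h4
  exact (esymmExp_injective (add_left_cancel h4)).symm

theorem cartier_alternant_mul_of_ne [Nontrivial B] (q : ℕ) [NeZero q] {t : Fin n →₀ ℕ}
    (ht : ∀ i, t i < q) (hne : t ≠ constExp n q) :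
    cartier q (alternant n B * esymmSubst n B (monomial t 1)) = 0 :=
  ((isAlternating_alternant_mul _).cartier q).eq_zero fun _ hb =>
    (lex_le_staircase_of_coeff_cartier q hb ht).2 hne

theorem cartier_alternant_mul_constExp [Nontrivial B] (q : ℕ) [NeZero q] :
    cartier q (alternant n B * esymmSubst n B (monomial (constExp n q) 1)) = alternant n B := by
  rw [← sub_eq_zero]
  refine (((isAlternating_alternant_mul _).cartier q).sub isAlternating_alternant).eq_zero
    fun b hb => ?_
  have hle : toLex b ≤ toLex (staircase n) := by
    by_contra hcon
    apply hb
    rw [coeff_sub, leadsAt_alternant.2 b (not_le.mp hcon), sub_zero]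
    by_contra h
    exact hcon (lex_le_staircase_of_coeff_cartier q h fun i => by
      simpa using Nat.pos_of_neZero q).1
  refine lt_of_le_of_ne hle fun heq => hb ?_
  have hbs : b = staircase n := toLex.injective heq
  rw [hbs, coeff_sub, leadsAt_alternant.1, coeff_cartier, ← staircase_add_esymmExp_constExp,
    (leadsAt_alternant_mul _).1, sub_self]

variable (F : Type*) [Field F] [Fintype F] [Algebra F B]

/-- The elementary symmetric polynomials have coefficients in `𝔽_q`, so their `q`-th powers are given
by `x ↦ x ^ q` on the variables. -/
theorem esymm_pow_card (k : ℕ) :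
    esymm (Fin n) B k ^ Fintype.card F = expand (Fintype.card F) (esymm (Fin n) B k) := by
  have h : ∀ x : MvPolynomial (Fin n) B,
      x ^ Fintype.card F = FiniteField.frobeniusAlgHom F (MvPolynomial (Fin n) B) x := fun _ => rfl
  rw [h, esymm, map_sum, map_sum]
  refine sum_congr rfl fun t _ => ?_
  rw [map_prod, map_prod]
  refine prod_congr rfl fun i _ => ?_
  rw [← h, expand_X]

theorem esymmSubst_monomial_card_smul (s : Fin n →₀ ℕ) :
    esymmSubst n B (monomial (Fintype.card F • s) 1) =
      expand (Fintype.card F) (esymmSubst n B (monomial s 1)) := by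
  rw [esymmSubst, aeval_monomial, aeval_monomial, map_one, one_mul, one_mul,
    Finsupp.prod_fintype _ _ (fun _ => pow_zero _), Finsupp.prod_fintype _ _ (fun _ => pow_zero _),
    map_prod]
  refine prod_congr rfl fun i _ => ?_
  rw [map_pow, ← esymm_pow_card F, ← pow_mul, Finsupp.smul_apply, smul_eq_mul]

/-- The Cartier operator does not depend on the coordinates: dividing by the alternant, that is, by
the Jacobian determinant of `e₁, …, eₙ`, turns the operator in the variables `x₁, …, xₙ` into the
one in the variables `e₁, …, eₙ`. -/
theorem cartier_alternant_mul_esymmSubst [Nontrivial B] [NeZero (Fintype.card F)]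
    (h : MvPolynomial (Fin n) B) :
    cartier (Fintype.card F) (alternant n B * esymmSubst n B h) =
      alternant n B * esymmSubst n B (cartier (Fintype.card F) h) := by
  classical
  have hq : 0 < Fintype.card F := Fintype.card_pos
  induction h using MvPolynomial.induction_on' with
  | add p p' hp hp' => rw [map_add, mul_add, cartier_add, hp, hp', cartier_add, map_add, mul_add]
  | monomial k c =>
    set q := Fintype.card F with hqdef
    have hc : (monomial k c : MvPolynomial (Fin n) B) = C c * monomial k 1 := by
      rw [C_mul_monomial, mul_one]
    -- Division with remainder by `q` in each exponent.
    let s : Fin n →₀ ℕ := Finsupp.equivFunOnFinite.symm fun i => k i / q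
    let t : Fin n →₀ ℕ := Finsupp.equivFunOnFinite.symm fun i => k i % q
    have hk : k = q • s + t := by
      ext i
      exact (Nat.div_add_mod (k i) q).symm
    have ht : ∀ i, t i < q := fun i => Nat.mod_lt _ hq
    have hmon : (monomial k 1 : MvPolynomial (Fin n) B) = monomial (q • s) 1 * monomial t 1 := by
      rw [monomial_mul, ← hk, mul_one]
    have hC : ∀ p : MvPolynomial (Fin n) B, esymmSubst n B (C c * p) = C c * esymmSubst n B p := by
      intro p
      rw [map_mul, esymmSubst, aeval_C]
      rfl
    rw [hc, hC, mul_left_comm, cartier_C_mul, cartier_C_mul, hC, mul_left_comm]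
    congr 1
    rw [hmon, map_mul, esymmSubst_monomial_card_smul, mul_left_comm, cartier_expand_mul,
      show (monomial (q • s) (1 : B)) = expand q (monomial s 1) from (expand_monomial _ _ _).symm,
      cartier_expand_mul, map_mul]
    have hself : ∀ b, coeff b (cartier q (monomial t (1 : B))) =
        if t = constExp n q ∧ b = 0 then 1 else 0 := by
      intro b
      rw [coeff_cartier, coeff_monomial]
      refine if_congr ⟨fun h => ?_, ?_⟩ rfl rfl
      · have hb : b = 0 := by
          ext i
          have h1 := DFunLike.congr_fun h i
          have h2 := ht i
          rw [h1, cartierExp_apply] at h2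
          by_contra hbi
          have : q * 2 ≤ q * (b i + 1) := Nat.mul_le_mul_left _ (by
            have : b i ≠ 0 := hbi
            omega)
          omega
        refine ⟨?_, hb⟩
        rw [h, hb]
        ext i
        simp
      · rintro ⟨h, rfl⟩
        rw [h]
        ext i
        simp
    by_cases hcase : t = constExp n q
    · have h1 : cartier q (monomial t (1 : B)) = 1 := by
        ext b
        rw [hself, coeff_one]
        simp [hcase, eq_comm]
      rw [h1, hcase, cartier_alternant_mul_constExp, map_one (esymmSubst n B), mul_one, mul_comm]
    · have h1 : cartier q (monomial t (1 : B)) = 0 := by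
        ext b
        rw [hself]
        simp [hcase]
      rw [h1, cartier_alternant_mul_of_ne q ht hcase, mul_zero, map_zero, mul_zero,
        mul_zero]

theorem coeff_prod_aeval_X (P : Fin n → B[X]) (b : Fin n →₀ ℕ) :
    coeff b (∏ i, Polynomial.aeval (X i : MvPolynomial (Fin n) B) (P i)) =
      ∏ i, (P i).coeff (b i) := by
  classical
  obtain ⟨N, hN⟩ : ∃ N, ∀ i, (P i).natDegree < N :=
    ⟨(univ.sup fun i => (P i).natDegree) + 1, fun i =>
      Nat.lt_succ_of_le (le_sup (f := fun i => (P i).natDegree) (mem_univ i))⟩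
  have h1 : ∀ i, Polynomial.aeval (X i : MvPolynomial (Fin n) B) (P i) =
      ∑ k ∈ range N, monomial (Finsupp.single i k) ((P i).coeff k) := by
    intro i
    rw [Polynomial.aeval_eq_sum_range' (hN i)]
    refine sum_congr rfl fun k _ => ?_
    rw [X_pow_eq_monomial, smul_monomial, smul_eq_mul, mul_one]
  simp only [h1]
  rw [prod_univ_sum, coeff_sum]
  have h2 : ∀ f : Fin n → ℕ, ∏ i, (monomial (Finsupp.single i (f i)) ((P i).coeff (f i)) :
      MvPolynomial (Fin n) B) = monomial (Finsupp.equivFunOnFinite.symm f)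
        (∏ i, (P i).coeff (f i)) := by
    intro f
    rw [← monomial_sum_prod]
    congr 2
    refine Finsupp.ext fun i => ?_
    simp [Finsupp.single_apply]
  simp only [h2, coeff_monomial]
  rw [sum_eq_single (b : Fin n → ℕ)]
  · rw [if_pos (by ext; rfl)]
  · intro f _ hf
    refine if_neg fun h => hf ?_
    rw [← h]
    rfl
  · intro hb
    rw [if_pos (by ext; rfl)]
    simp only [Fintype.mem_piFinset, mem_range, not_forall, not_lt] at hb
    obtain ⟨i, hi⟩ := hb
    exact prod_eq_zero (mem_univ i) (Polynomial.coeff_eq_zero_of_natDegree_lt ((hN i).trans_le hi))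

theorem coeff_cartier_mul_prod (q : ℕ) [NeZero q] (Q : B[X]) (p : MvPolynomial (Fin n) B)
    (b : Fin n →₀ ℕ) :
    coeff b (cartier q (p * ∏ i, Polynomial.aeval (X i : MvPolynomial (Fin n) B) Q)) =
      ∑ c ∈ p.support, coeff c p * ∏ i, (Q * Polynomial.X ^ c i).coeff (q * (b i + 1) - 1) := by
  conv_lhs => rw [p.as_sum, sum_mul, coeff_cartier, coeff_sum]
  refine sum_congr rfl fun c _ => ?_
  have h : (monomial c (coeff c p) : MvPolynomial (Fin n) B) *
      ∏ i, Polynomial.aeval (X i : MvPolynomial (Fin n) B) Q =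
      C (coeff c p) * ∏ i, Polynomial.aeval (X i : MvPolynomial (Fin n) B)
        (Q * Polynomial.X ^ c i) := by
    rw [monomial_eq, Finsupp.prod_fintype _ _ (fun _ => pow_zero _), mul_assoc,
      ← prod_mul_distrib]
    congr 1
    refine prod_congr rfl fun i _ => ?_
    rw [map_mul, map_pow, Polynomial.aeval_X, mul_comm]
  rw [h, coeff_C_mul, coeff_prod_aeval_X]
  rfl

/-- Expanding `alternant * esymmSubst g` in the lexicographic order recovers the coefficient of `g`
with the highest leading exponent. -/
theorem coeff_of_alternant_mul_esymmSubst [Nontrivial B] {g : MvPolynomial (Fin n) B}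
    {m : Fin n →₀ ℕ}
    (h : ∀ b, toLex (staircase n + esymmExp m) < toLex b →
      coeff b (alternant n B * esymmSubst n B g) = 0) :
    coeff (staircase n + esymmExp m) (alternant n B * esymmSubst n B g) = coeff m g := by
  have hsum : ∀ b, coeff b (alternant n B * esymmSubst n B g) = ∑ k ∈ g.support, coeff k g *
      coeff b (alternant n B * esymmSubst n B (monomial k 1)) := by
    intro b
    conv_lhs => rw [g.as_sum, map_sum, mul_sum, coeff_sum]
    refine sum_congr rfl fun k _ => ?_
    rw [← coeff_C_mul, mul_left_comm]
    congr 2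
    rw [← mul_one (coeff k g), ← C_mul_monomial, map_mul, mul_one, esymmSubst, aeval_C]
    rfl
  have hmono : ∀ {s t : Fin n →₀ ℕ}, toLex (esymmExp s) < toLex (esymmExp t) →
      toLex (staircase n + esymmExp s) < toLex (staircase n + esymmExp t) := fun hst => by
    rw [toLex_add, toLex_add]
    exact add_lt_add_right hst _
  -- The coefficient at the leading exponent of the highest term of `g`.
  have htop : ∀ k, (∀ k', coeff k' g ≠ 0 → toLex (esymmExp k') ≤ toLex (esymmExp k)) →
      coeff (staircase n + esymmExp k) (alternant n B * esymmSubst n B g) = coeff k g := by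
    intro k hk
    rw [hsum, sum_eq_single k]
    · rw [(leadsAt_alternant_mul k).1, mul_one]
    · intro k' hk' hne
      rw [(leadsAt_alternant_mul k').2 _ (hmono (lt_of_le_of_ne
        (hk k' (MvPolynomial.mem_support_iff.mp hk'))
        fun heq => hne (esymmExp_injective (toLex.injective heq)))), mul_zero]
    · intro hk'
      rw [MvPolynomial.notMem_support_iff.mp hk', zero_mul]
  refine htop m fun k' hk' => ?_
  obtain ⟨k, hk, hmax⟩ := exists_max_image g.support (fun k => toLex (esymmExp k))
    ⟨k', MvPolynomial.mem_support_iff.mpr hk'⟩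
  refine (hmax k' (MvPolynomial.mem_support_iff.mpr hk')).trans (not_lt.mp fun hlt => ?_)
  have h1 := h _ (hmono hlt)
  rw [htop k fun k'' hk'' => hmax k'' (MvPolynomial.mem_support_iff.mpr hk'')] at h1
  exact MvPolynomial.mem_support_iff.mp hk h1

/-- Let the operator `p ↦ cartier (Q * p)` on `B[θ]` be triangular in the basis of monomials, with
diagonal entries `d 0, d 1, …`, and let `G` express `Q(x₁) ⋯ Q(xₙ)` in the elementary symmetric
polynomials. Then the coefficients of `G` that contribute to the trace of `cartier (G * ·)` are
the products of `n` diagonal entries with distinct indices, that is, the diagonal entries of the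
`n`-th exterior power. -/
theorem coeff_of_esymmSubst_eq_prod [Nontrivial B] [NeZero (Fintype.card F)] {Q : B[X]}
    {d : ℕ → B}
    (hlow : ∀ a b, a < b → (Q * Polynomial.X ^ a).coeff (Fintype.card F * (b + 1) - 1) = 0)
    (hdiag : ∀ a, (Q * Polynomial.X ^ a).coeff (Fintype.card F * (a + 1) - 1) = d a)
    {G : MvPolynomial (Fin n) B}
    (hG : esymmSubst n B G = ∏ i, Polynomial.aeval (X i : MvPolynomial (Fin n) B) Q)
    (m : Fin n →₀ ℕ) :
    coeff (cartierExp (Fintype.card F) m) (monomial m 1 * G) =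
      ∏ i, d ((staircase n + esymmExp m) i) := by
  classical
  set q := Fintype.card F with hq
  set a := staircase n + esymmExp m with ha
  have hkey : ∀ b, coeff b (alternant n B * esymmSubst n B (cartier q (monomial m 1 * G))) =
      ∑ c ∈ (alternant n B * esymmSubst n B (monomial m 1)).support,
        coeff c (alternant n B * esymmSubst n B (monomial m 1)) *
          ∏ i, (Q * Polynomial.X ^ c i).coeff (q * (b i + 1) - 1) := by
    intro b
    rw [← cartier_alternant_mul_esymmSubst F, map_mul, hG, ← mul_assoc, coeff_cartier_mul_prod]
  -- A nonzero summand forces `b ≤ c` in every entry, and `c` is at most `a` lexicographically.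
  have hzero : ∀ b c, toLex a ≤ toLex b → c ≠ a →
      coeff c (alternant n B * esymmSubst n B (monomial m 1)) *
          ∏ i, (Q * Polynomial.X ^ c i).coeff (q * (b i + 1) - 1) = 0 := by
    intro b c hb hc
    by_contra hne
    have h1 := (leadsAt_alternant_mul m).lex_le (left_ne_zero_of_mul hne)
    have h2 : b ≤ c := by
      intro i
      by_contra hlt
      exact right_ne_zero_of_mul hne (prod_eq_zero (mem_univ i) (hlow _ _ (not_le.mp hlt)))
    have h3 : toLex c = toLex a := le_antisymm h1 (hb.trans (Finsupp.toLex_monotone h2))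
    exact hc (toLex.injective h3)
  rw [← coeff_cartier, ← coeff_of_alternant_mul_esymmSubst, ← ha, hkey, sum_eq_single a]
  · rw [(leadsAt_alternant_mul m).1, one_mul]
    exact prod_congr rfl fun i _ => hdiag _
  · exact fun c _ hc => hzero a c le_rfl hc
  · intro h
    rw [MvPolynomial.notMem_support_iff.mp h, zero_mul]
  · intro b hb
    rw [hkey]
    refine sum_eq_zero fun c _ => ?_
    by_cases hc : c = a
    · by_contra hne
      have h2 : b ≤ c := by
        intro i
        by_contra hlt
        exact right_ne_zero_of_mul hne (prod_eq_zero (mem_univ i) (hlow _ _ (not_le.mp hlt)))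
      rw [hc] at h2
      exact (Finsupp.toLex_monotone h2).not_gt hb
    · exact hzero b c hb.le hc

end CartierEsymm

end MvPolynomial

/-! ### Sums over rational points -/

namespace MvPolynomial

section PointSum

open Finset

variable {n : ℕ} {B : Type*} [CommRing B] (F : Type*) [Field F] [Fintype F] [Algebra F B]

theorem sum_pow_eq_ite (k : ℕ) :
    ∑ c : F, c ^ k = if 0 < k ∧ Fintype.card F - 1 ∣ k then -1 else 0 := by
  classical
  rcases Nat.eq_zero_or_pos k with rfl | hk
  · simp
  · rw [← FiniteField.sum_pow_units F k |>.trans (by simp [hk] :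
      (if Fintype.card F - 1 ∣ k then (-1 : F) else 0) =
        if 0 < k ∧ Fintype.card F - 1 ∣ k then -1 else 0),
      ← Fintype.sum_subtype_add_sum_subtype (fun c : F => c ≠ 0)]
    have h0 : ∑ c : {c : F // ¬c ≠ 0}, (c : F) ^ k = 0 :=
      sum_eq_zero fun c _ => by rw [not_not.mp c.2, zero_pow hk.ne']
    rw [h0, add_zero]
    exact Fintype.sum_equiv unitsEquivNeZero.symm _ _ fun c => rfl

variable {F}

/-- The exponent with entries `(q - 1) (m i + 1)`. -/
def kummerExp (q : ℕ) (m : Fin n →₀ ℕ) : Fin n →₀ ℕ :=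
  Finsupp.equivFunOnFinite.symm fun i => (q - 1) * (m i + 1)

@[simp]
theorem kummerExp_apply (q : ℕ) (m : Fin n →₀ ℕ) (i : Fin n) :
    kummerExp q m i = (q - 1) * (m i + 1) := rfl

/-- Only the monomials all of whose exponents are positive multiples of `q - 1` contribute to the
sum of a polynomial over `𝔽_q`-rational points. -/
theorem sum_eval_algebraMap (G : MvPolynomial (Fin n) B) :
    ∑ c : Fin n → F, eval (fun i => algebraMap F B (c i)) G =
      ∑ k ∈ G.support, coeff k G *
        ∏ i, (if 0 < k i ∧ Fintype.card F - 1 ∣ k i then -1 else 0) := by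
  simp only [eval_eq']
  rw [sum_comm]
  refine sum_congr rfl fun k _ => ?_
  rw [← mul_sum]
  congr 1
  have h := prod_univ_sum (fun _ : Fin n => (univ : Finset F))
    (fun i c => algebraMap F B c ^ k i)
  rw [Fintype.piFinset_univ] at h
  rw [← h]
  refine prod_congr rfl fun i _ => ?_
  have := congrArg (algebraMap F B) (sum_pow_eq_ite F (k i))
  rw [map_sum] at this
  simp only [map_pow] at this
  rw [this]
  split_ifs <;> simp

/-- The exponents `m` with `n + |m| ≤ r`. -/
def expFinset (n r : ℕ) : Finset (Fin n →₀ ℕ) :=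
  (range (r + 1 - n)).biUnion fun k => finsuppAntidiag univ k

theorem mem_expFinset {r : ℕ} {m : Fin n →₀ ℕ} : m ∈ expFinset n r ↔ n + ∑ i, m i ≤ r := by
  simp only [expFinset, mem_biUnion, mem_range, mem_finsuppAntidiag, subset_univ, and_true,
    exists_eq_right']
  change univ.sum (fun i => m i) < _ ↔ _
  omega

theorem card_expFinset (n r : ℕ) : #(expFinset n r) = r.choose n := by
  rw [expFinset, card_biUnion]
  · simp only [card_finsuppAntidiag_nat_eq_multichoose, card_univ, Fintype.card_fin]
    rcases le_or_gt n r with h | h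
    · rw [Nat.sub_add_comm h, Nat.sum_range_multichoose, Nat.sub_add_cancel h]
    · rw [Nat.choose_eq_zero_of_lt h, show r + 1 - n = 0 by omega, range_zero, sum_empty]
  · intro i _ j _ hij
    rw [Function.onFun, disjoint_left]
    intro m hi hj
    rw [mem_finsuppAntidiag] at hi hj
    exact hij (hi.1.symm.trans hj.1)

/-- The entries of `staircase n + esymmExp m` decrease; for `n > 0` the largest is `n - 1 + |m|`. -/
theorem forall_staircase_add_esymmExp_lt {r : ℕ} {m : Fin n →₀ ℕ} :
    (∀ i, (staircase n + esymmExp m) i < r) ↔ n + ∑ i, m i ≤ r := by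
  constructor
  · intro h
    rcases Nat.eq_zero_or_pos n with rfl | hn
    · simp
    · have h0 := h ⟨0, hn⟩
      simp only [Finsupp.add_apply, staircase_apply, esymmExp_apply, Nat.zero_le,
        filter_true] at h0
      omega
  · intro h i
    have h1 : esymmExp m i ≤ ∑ i, m i := by
      rw [esymmExp_apply]
      exact sum_le_sum_of_subset (subset_univ _)
    have h2 := i.2
    simp only [Finsupp.add_apply, staircase_apply]
    omega

/-- If the operator `p ↦ cartier (Q * p)` on `B[θ]` is triangular with diagonal entries `1` (`r`
times) and `0` otherwise, then the sum of `Q(x₁) ⋯ Q(xₙ)` over all `𝔽_q`-rational values of the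
elementary symmetric polynomials is `(-1)ⁿ` times the trace of the `n`-th exterior power of this
operator, which is `r.choose n`. -/
theorem sum_eval_of_esymmSubst_eq_prod [Nontrivial B] {Q : B[X]} {r : ℕ}
    (hlow : ∀ a b, a < b → (Q * Polynomial.X ^ a).coeff (Fintype.card F * (b + 1) - 1) = 0)
    (hdiag : ∀ a, (Q * Polynomial.X ^ a).coeff (Fintype.card F * (a + 1) - 1) =
      if a < r then 1 else 0)
    {G : MvPolynomial (Fin n) B}
    (hG : esymmSubst n B G = ∏ i, Polynomial.aeval (X i : MvPolynomial (Fin n) B) Q) :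
    ∑ c : Fin n → F, eval (fun i => algebraMap F B (c i)) G = (-1) ^ n * (r.choose n : B) := by
  classical
  have : NeZero (Fintype.card F) := ⟨Fintype.card_ne_zero⟩
  have hq : 1 < Fintype.card F := Fintype.one_lt_card
  set q := Fintype.card F with hqdef
  have hcoeff : ∀ m : Fin n →₀ ℕ, coeff (kummerExp q m) G =
      if m ∈ expFinset n r then 1 else 0 := by
    intro m
    have h1 := coeff_of_esymmSubst_eq_prod (F := F) hlow hdiag hG m
    have h2 : cartierExp q m = m + kummerExp q m := by
      ext i
      simp only [cartierExp_apply, Finsupp.add_apply, kummerExp_apply]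
      obtain ⟨s, hs⟩ : ∃ s, q = s + 1 := ⟨q - 1, by omega⟩
      rw [hs, Nat.add_sub_cancel]
      have : (s + 1) * (m i + 1) = m i + s * (m i + 1) + 1 := by ring
      omega
    rw [← hqdef, h2, coeff_monomial_mul, one_mul] at h1
    rw [h1]
    by_cases hm : m ∈ expFinset n r
    · rw [if_pos hm]
      rw [mem_expFinset, ← forall_staircase_add_esymmExp_lt] at hm
      exact prod_eq_one fun i _ => if_pos (hm i)
    · rw [if_neg hm]
      rw [mem_expFinset, ← forall_staircase_add_esymmExp_lt, not_forall] at hm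
      obtain ⟨i, hi⟩ := hm
      exact prod_eq_zero (mem_univ i) (if_neg hi)
  have hinj : Function.Injective (kummerExp q : (Fin n →₀ ℕ) → _) := by
    intro a b h
    ext i
    have hi := DFunLike.congr_fun h i
    simp only [kummerExp_apply] at hi
    exact Nat.succ_injective (Nat.eq_of_mul_eq_mul_left (by omega) hi)
  have hmul : ∀ m : Fin n →₀ ℕ,
      ∏ i, (if 0 < kummerExp q m i ∧ q - 1 ∣ kummerExp q m i then (-1 : B) else 0) =
        (-1) ^ n := by
    intro m
    rw [prod_congr rfl fun i _ => if_pos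
      ⟨Nat.mul_pos (by omega) (Nat.succ_pos _), Dvd.intro _ rfl⟩, prod_const, card_univ,
      Fintype.card_fin]
  rw [sum_eval_algebraMap, ← hqdef]
  have h3 : ((-1) ^ n * (r.choose n : B)) = ∑ k ∈ (expFinset n r).image (kummerExp q),
      coeff k G * ∏ i, (if 0 < k i ∧ q - 1 ∣ k i then -1 else 0) := by
    rw [sum_image hinj.injOn, sum_congr rfl fun m hm => by rw [hcoeff, if_pos hm, hmul, one_mul],
      sum_const, card_expFinset, nsmul_eq_mul, mul_comm]
  rw [h3]
  refine sum_congr_of_eq_on_inter ?_ ?_ fun _ _ _ => rfl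
  · intro k _ hk
    by_contra hne
    have h4 : ∀ i, 0 < k i ∧ q - 1 ∣ k i := by
      by_contra hcon
      obtain ⟨i, hi⟩ := not_forall.mp hcon
      exact right_ne_zero_of_mul hne (prod_eq_zero (mem_univ i) (if_neg hi))
    have h5 : k = kummerExp q (Finsupp.equivFunOnFinite.symm fun i => k i / (q - 1) - 1) := by
      ext i
      obtain ⟨h6, c, hc⟩ := h4 i
      have h7 : c ≠ 0 := by
        rintro rfl
        omega
      simp only [kummerExp_apply, Finsupp.coe_equivFunOnFinite_symm]
      rw [hc, Nat.mul_div_cancel_left _ (by omega), Nat.sub_add_cancel (by omega)]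
    rw [h5, hcoeff] at hne
    refine hk (mem_image.mpr ⟨_, ?_, h5.symm⟩)
    by_contra hmem
    exact hne (by rw [if_neg hmem, zero_mul])
  · intro k _ hk
    rw [MvPolynomial.notMem_support_iff.mp hk, zero_mul]

end PointSum

end MvPolynomial

/-! ### The Euler product -/

namespace CarlitzTwist

section Euler

open Finset

section Monic

variable {F : Type*} [Field F]

/-- The monic polynomial `∏ (θ - αᵢ)` of degree `n` whose roots have the elementary symmetric
functions `c₁, …, cₙ`. -/
def monicOfEsymm {n : ℕ} (c : Fin n → F) : F[X] :=
  X ^ n + ∑ i : Fin n, C ((-1) ^ (i + 1 : ℕ) * c i) * X ^ (n - 1 - i : ℕ)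

theorem coeff_monicOfEsymm {n : ℕ} (c : Fin n → F) (i : Fin n) :
    (monicOfEsymm c).coeff (n - (i + 1)) = (-1) ^ (i + 1 : ℕ) * c i := by
  have hi := i.2
  simp only [monicOfEsymm, coeff_add, finsetSum_coeff, coeff_C_mul, coeff_X_pow]
  rw [if_neg (by omega), zero_add, sum_eq_single i]
  · rw [if_pos (by omega), mul_one]
  · intro j _ hj
    have := j.2
    rw [if_neg fun h => hj (Fin.ext (by omega)), mul_zero]
  · simp

theorem degree_sum_monicOfEsymm_lt {n : ℕ} (c : Fin n → F) :
    (∑ i : Fin n, C ((-1) ^ (i + 1 : ℕ) * c i) * X ^ (n - 1 - i : ℕ)).degree < (n : WithBot ℕ) := by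
  rw [← mem_degreeLT]
  refine Submodule.sum_mem _ fun i _ => ?_
  rw [mem_degreeLT]
  have hi := i.2
  exact (degree_C_mul_X_pow_le _ _).trans_lt (by exact_mod_cast (by omega : n - 1 - (i : ℕ) < n))

theorem monic_monicOfEsymm {n : ℕ} (c : Fin n → F) : (monicOfEsymm c).Monic :=
  monic_X_pow_add (degree_sum_monicOfEsymm_lt c)

theorem natDegree_monicOfEsymm {n : ℕ} (c : Fin n → F) : (monicOfEsymm c).natDegree = n := by
  refine natDegree_eq_of_degree_eq_some ?_
  rw [monicOfEsymm, degree_add_eq_left_of_degree_lt, degree_X_pow]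
  rw [degree_X_pow]
  exact degree_sum_monicOfEsymm_lt c

theorem monicOfEsymm_injective (n : ℕ) :
    Function.Injective (monicOfEsymm : (Fin n → F) → F[X]) := by
  intro c c' h
  ext i
  have := congrArg (fun f => coeff f (n - (i + 1))) h
  simp only [coeff_monicOfEsymm] at this
  exact mul_left_cancel₀ (pow_ne_zero _ (neg_ne_zero.mpr one_ne_zero)) this

theorem exists_monicOfEsymm_eq {f : F[X]} (hf : f.Monic) :
    ∃ c : Fin f.natDegree → F, monicOfEsymm c = f := by
  refine ⟨fun i => (-1) ^ (i + 1 : ℕ) * f.coeff (f.natDegree - (i + 1)), ?_⟩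
  ext k
  rcases lt_trichotomy k f.natDegree with hk | rfl | hk
  · obtain ⟨i, hi⟩ : ∃ i : Fin f.natDegree, f.natDegree - (i + 1) = k :=
      ⟨⟨f.natDegree - (k + 1), by omega⟩, by simp only; omega⟩
    rw [← hi, coeff_monicOfEsymm, ← mul_assoc, ← mul_pow]
    simp
  · have h1 := (monic_monicOfEsymm fun i : Fin f.natDegree =>
      (-1) ^ (i + 1 : ℕ) * f.coeff (f.natDegree - (i + 1))).coeff_natDegree
    rw [natDegree_monicOfEsymm] at h1
    rw [h1, hf.coeff_natDegree]
  · rw [coeff_eq_zero_of_natDegree_lt hk, coeff_eq_zero_of_natDegree_lt]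
    rwa [natDegree_monicOfEsymm]

theorem exists_finitePrime_dvd {f : F[X]} (hf0 : f ≠ 0) (hf : ¬IsUnit f) : ∃ p : FinitePrime F, p.1 ∣ f := by
  obtain ⟨g, hg, hgf⟩ := WfDvdMonoid.exists_irreducible_factor hf hf0
  refine ⟨⟨g * C g.leadingCoeff⁻¹, monic_mul_leadingCoeff_inv hg.ne_zero, ?_⟩, ?_⟩
  · exact (associated_mul_unit_right g _ (isUnit_C.mpr
      (inv_ne_zero (leadingCoeff_ne_zero.mpr hg.ne_zero)).isUnit)).irreducible hg
  · exact ((associated_mul_unit_right g _ (isUnit_C.mpr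
      (inv_ne_zero (leadingCoeff_ne_zero.mpr hg.ne_zero)).isUnit)).symm.dvd).trans hgf

theorem eq_of_dvd_finitePrime {p p' : FinitePrime F} (h : p.1 ∣ p'.1) : p = p' :=
  Subtype.ext (eq_of_monic_of_associated p.2.1 p'.2.1 (p.2.2.associated_of_dvd p'.2.2 h))

end Monic

variable {F : Type*} [Field F] [Fintype F]

open Classical in
/-- The monic polynomials of degree `n` over `𝔽_q`. -/
def monicFinset (F : Type*) [Field F] [Fintype F] (n : ℕ) : Finset F[X] :=
  univ.image (monicOfEsymm : (Fin n → F) → F[X])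

theorem mem_monicFinset {n : ℕ} {f : F[X]} :
    f ∈ monicFinset F n ↔ f.Monic ∧ f.natDegree = n := by
  classical
  simp only [monicFinset, mem_image, mem_univ, true_and]
  constructor
  · rintro ⟨c, rfl⟩
    exact ⟨monic_monicOfEsymm c, natDegree_monicOfEsymm c⟩
  · rintro ⟨hf, rfl⟩
    exact exists_monicOfEsymm_eq hf

open Classical in
/-- The monic polynomials of degree `n` all of whose prime factors lie in `s`. -/
def smoothFinset (s : Finset (FinitePrime F)) (n : ℕ) : Finset F[X] :=
  {f ∈ monicFinset F n | ∀ p : FinitePrime F, p.1 ∣ f → p ∈ s}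

theorem mem_smoothFinset {s : Finset (FinitePrime F)} {n : ℕ} {f : F[X]} :
    f ∈ smoothFinset s n ↔
      (f.Monic ∧ f.natDegree = n) ∧ ∀ p : FinitePrime F, p.1 ∣ f → p ∈ s := by
  classical
  rw [smoothFinset, mem_filter, mem_monicFinset]

theorem smoothFinset_primesLE (n : ℕ) : smoothFinset (primesLE F n) n = monicFinset F n := by
  classical
  refine filter_true_of_mem fun f hf p hp => ?_
  rw [mem_monicFinset] at hf
  refine (Set.Finite.mem_toFinset _).mpr (?_ : p.1.natDegree ≤ n)
  rw [← hf.2]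
  exact natDegree_le_of_dvd hp hf.1.ne_zero

variable {R : Type*} [CommRing R]

/-- The generating series `∑ χ(f) U^(deg f)` over the monic polynomials `f` all of whose prime
factors lie in `s`. -/
def smoothSeries (χ : F[X] → R) (s : Finset (FinitePrime F)) : PowerSeries R :=
  PowerSeries.mk fun n => ∑ f ∈ smoothFinset s n, χ f

theorem smoothSeries_empty {χ : F[X] → R} (h1 : χ 1 = 1) : smoothSeries χ ∅ = 1 := by
  have hunit : ∀ {n : ℕ} {f : F[X]}, f ∈ smoothFinset ∅ n → f = 1 := by
    intro n f hf
    rw [mem_smoothFinset] at hf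
    by_contra hne
    obtain ⟨p, hp⟩ := exists_finitePrime_dvd hf.1.1.ne_zero (mt hf.1.1.isUnit_iff.mp hne)
    exact absurd (hf.2 p hp) (notMem_empty p)
  ext n
  rw [smoothSeries, PowerSeries.coeff_mk, PowerSeries.coeff_one]
  split_ifs with hn
  · rw [hn, ← h1]
    rw [← sum_singleton χ 1]
    congr 1
    ext f
    rw [mem_singleton]
    refine ⟨hunit, ?_⟩
    rintro rfl
    rw [mem_smoothFinset]
    exact ⟨⟨monic_one, natDegree_one⟩, fun p hp => absurd (isUnit_of_dvd_one hp) p.2.2.not_isUnit⟩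
  · refine sum_eq_zero fun f hf => absurd ?_ hn
    have h2 := (mem_smoothFinset.mp hf).1.2
    rw [hunit hf, natDegree_one] at h2
    exact h2.symm

/-- Sort the polynomials counted by `smoothSeries χ (insert p s)` by divisibility by `p`. -/
theorem mul_smoothSeries_insert [DecidableEq (FinitePrime F)] {χ : F[X] → R}
    (hmul : ∀ f g, f.Monic → g.Monic → χ (f * g) = χ f * χ g) {s : Finset (FinitePrime F)}
    {p : FinitePrime F} (hp : p ∉ s) :
    (1 - PowerSeries.X ^ p.1.natDegree * PowerSeries.C (χ p.1)) * smoothSeries χ (insert p s) =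
      smoothSeries χ s := by
  classical
  ext n
  rw [sub_mul, one_mul, map_sub, mul_assoc, PowerSeries.coeff_X_pow_mul', smoothSeries,
    smoothSeries, PowerSeries.coeff_mk, PowerSeries.coeff_mk, sub_eq_iff_eq_add']
  have hnot : ∀ f ∈ smoothFinset (insert p s) n, ¬p.1 ∣ f ↔ f ∈ smoothFinset s n := by
    intro f hf
    rw [mem_smoothFinset] at hf ⊢
    constructor
    · refine fun h => ⟨hf.1, fun p' hp' => ?_⟩
      rcases mem_insert.mp (hf.2 p' hp') with rfl | h'
      · exact absurd hp' h
      · exact h'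
    · exact fun h hpf => hp (h.2 p hpf)
  rw [← sum_filter_add_sum_filter_not (smoothFinset (insert p s) n) (fun f => p.1 ∣ f)]
  congr 1
  · split_ifs with hn
    · rw [PowerSeries.coeff_C_mul, PowerSeries.coeff_mk, mul_sum]
      symm
      refine sum_nbij (fun g => p.1 * g) ?_ ?_ ?_ ?_
      · intro g hg
        rw [mem_smoothFinset] at hg
        rw [mem_filter, mem_smoothFinset]
        refine ⟨⟨⟨p.2.1.mul hg.1.1, ?_⟩, fun p' hp' => ?_⟩, dvd_mul_right _ _⟩
        · rw [p.2.1.natDegree_mul hg.1.1, hg.1.2]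
          omega
        · rcases p'.2.2.prime.dvd_or_dvd hp' with h | h
          · rw [eq_of_dvd_finitePrime h]
            exact mem_insert_self _ _
          · exact hg.2 p' h
      · exact fun g _ g' _ h => mul_left_cancel₀ p.2.2.ne_zero h
      · intro f hf
        rw [mem_coe, mem_filter, mem_smoothFinset] at hf
        obtain ⟨⟨⟨hf1, hf2⟩, hf3⟩, g, rfl⟩ := hf
        have hg : g.Monic := p.2.1.of_mul_monic_left hf1
        refine ⟨g, ?_, rfl⟩
        rw [mem_coe, mem_smoothFinset]
        refine ⟨⟨hg, ?_⟩, fun p' hp' => hf3 p' (hp'.mul_left _)⟩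
        rw [p.2.1.natDegree_mul hg] at hf2
        omega
      · intro g hg
        rw [mem_smoothFinset] at hg
        exact (hmul _ _ p.2.1 hg.1.1).symm
    · refine sum_eq_zero fun f hf => absurd ?_ hn
      rw [mem_filter, mem_smoothFinset] at hf
      rw [← hf.1.1.2]
      exact natDegree_le_of_dvd hf.2 hf.1.1.1.ne_zero
  · refine sum_congr ?_ fun _ _ => rfl
    ext f
    rw [mem_filter]
    constructor
    · exact fun hf => (hnot f hf.1).mp hf.2
    · intro hf
      have hf' : f ∈ smoothFinset (insert p s) n := by
        rw [mem_smoothFinset] at hf ⊢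
        exact ⟨hf.1, fun p' hp' => mem_insert_of_mem (hf.2 p' hp')⟩
      exact ⟨hf', (hnot f hf').mpr hf⟩

theorem prod_mul_smoothSeries {χ : F[X] → R} (h1 : χ 1 = 1)
    (hmul : ∀ f g, f.Monic → g.Monic → χ (f * g) = χ f * χ g) (s : Finset (FinitePrime F)) :
    (∏ p ∈ s, (1 - PowerSeries.X ^ p.1.natDegree * PowerSeries.C (χ p.1))) * smoothSeries χ s =
      1 := by
  classical
  induction s using Finset.induction_on with
  | empty => rw [prod_empty, one_mul, smoothSeries_empty h1]
  | insert p s hp ih =>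
    rw [prod_insert hp, mul_comm (1 - _), mul_assoc, mul_smoothSeries_insert hmul hp, ih]

/-- The Euler product: if the local determinants become `1 - χ(𝔓) U^(deg 𝔓)` over an extension `R`
of `𝔽_q[T]`, with `χ` multiplicative, then `L = ∑ χ(f) U^(deg f)` over all monic `f`. -/
theorem map_coeff_LSeries {ι : Type*} [Fintype ι] [DecidableEq ι] {Q : Matrix ι ι F[X][X]}
    {χ : F[X] → R} (h1 : χ 1 = 1) (hmul : ∀ f g, f.Monic → g.Monic → χ (f * g) = χ f * χ g)
    (φ : F[X] →+* R)
    (hloc : ∀ p : FinitePrime F, (localDet Q p).map φ = 1 - X ^ p.1.natDegree * C (χ p.1))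
    (n : ℕ) : φ (PowerSeries.coeff n (LSeries Q)) = ∑ f ∈ monicFinset F n, χ f := by
  have hfac : ∀ p : FinitePrime F,
      (1 - PowerSeries.X ^ p.1.natDegree * PowerSeries.C (χ p.1)) *
        PowerSeries.map φ (localFactor Q p) = 1 := by
    intro p
    have h0 : PowerSeries.constantCoeff (localDet Q p : PowerSeries F[X]) =
        ((1 : F[X]ˣ) : F[X]) := by
      have h2 := (X_pow_dvd_iff.mp (X_pow_dvd_localDet Q p)) 0 p.2.2.natDegree_pos
      rw [coeff_sub, coeff_one_zero, sub_eq_zero] at h2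
      simpa using h2
    have h2 : (localDet Q p : PowerSeries F[X]) * localFactor Q p = 1 :=
      PowerSeries.mul_invOfUnit _ _ h0
    have h3 := congrArg (PowerSeries.map φ) h2
    rw [map_mul, map_one] at h3
    have h4 : PowerSeries.map φ (localDet Q p : PowerSeries F[X]) =
        (((localDet Q p).map φ : R[X]) : PowerSeries R) := by
      ext k
      simp
    rw [h4, hloc] at h3
    rw [mul_comm (PowerSeries.X ^ _)]
    simpa using h3
  have h5 : PowerSeries.map φ (∏ p ∈ primesLE F n, localFactor Q p) =
      smoothSeries χ (primesLE F n) := by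
    have h6 := prod_mul_smoothSeries h1 hmul (primesLE F n)
    have h7 := prod_congr (rfl : primesLE F n = primesLE F n) fun p _ => hfac p
    rw [prod_mul_distrib, prod_const_one] at h7
    rw [map_prod]
    exact (left_inv_eq_right_inv ((mul_comm _ _).trans h7) h6)
  rw [LSeries, PowerSeries.coeff_mk, ← PowerSeries.coeff_map, h5, smoothSeries,
    PowerSeries.coeff_mk, smoothFinset_primesLE]

end Euler

end CarlitzTwist

/-! ### Local factors -/

namespace CarlitzTwist

section Roots

open Finset

variable {F : Type u} [Field F] {K : Type*} [Field K] [Algebra F K]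

/-- The multiplicative function `f ↦ ∏ Q(α)` over the roots `α` of `f`, where `Q ∈ 𝔽_q[θ][T]` is
evaluated at `θ = α`. -/
def rootProd (K : Type*) [Field K] [Algebra F K] (Q : F[X][X]) (f : F[X]) : K[X] :=
  ((f.aroots K).map fun α => Q.map (aeval α : F[X] →ₐ[F] K).toRingHom).prod

theorem rootProd_one (Q : F[X][X]) : rootProd K Q 1 = 1 := by
  simp [rootProd]

theorem rootProd_mul (Q : F[X][X]) {f g : F[X]} (hf : f.Monic) (hg : g.Monic) :
    rootProd K Q (f * g) = rootProd K Q f * rootProd K Q g := by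
  rw [rootProd, aroots_mul (mul_ne_zero hf.ne_zero hg.ne_zero), Multiset.map_add,
    Multiset.prod_add, rootProd, rootProd]

variable [Fintype F]

theorem aeval_pow_card_pow (f : F[X]) (α : K) (i : ℕ) :
    aeval (α ^ Fintype.card F ^ i) f = aeval α f ^ Fintype.card F ^ i := by
  have h : ∀ x : K, ((FiniteField.frobeniusAlgHom F K) ^ i) x = x ^ Fintype.card F ^ i := by
    intro x
    induction i with
    | zero => simp
    | succ i ih =>
      rw [pow_succ', AlgHom.mul_apply, ih, pow_succ, pow_mul]
      rfl
  rw [← h, ← h, aeval_algHom_apply]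

/-- The roots of a prime of degree `d` are the `d` conjugates under Frobenius of any one of them. -/
theorem aroots_finitePrime [IsAlgClosed K] (p : FinitePrime F) {α : K} (hα : aeval α p.1 = 0) :
    p.1.aroots K = (Multiset.range p.1.natDegree).map fun i => α ^ Fintype.card F ^ i := by
  have : Fact (Irreducible p.1) := ⟨p.2.2⟩
  have hfin : Module.Finite F (Residue p.1) := p.2.1.finite_adjoinRoot
  have hfin' : Finite (Residue p.1) := Module.finite_of_finite F
  have horder : orderOf (FiniteField.frobeniusAlgHom F (Residue p.1)) = p.1.natDegree := by
    rw [FiniteField.orderOf_frobeniusAlgHom, (AdjoinRoot.powerBasis p.2.2.ne_zero).finrank,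
      AdjoinRoot.powerBasis_dim]
  let φ : Residue p.1 →ₐ[F] K := AdjoinRoot.liftAlgHom p.1 (Algebra.ofId F K) α hα
  have hφ : φ (AdjoinRoot.root p.1) = α := AdjoinRoot.liftAlgHom_root _ _ _ _
  have hfrob : ∀ (i : ℕ) (x : Residue p.1),
      ((FiniteField.frobeniusAlgHom F (Residue p.1)) ^ i) x = x ^ Fintype.card F ^ i := by
    intro i x
    induction i with
    | zero => simp
    | succ i ih =>
      rw [pow_succ', AlgHom.mul_apply, ih, pow_succ, pow_mul]
      rfl
  have hinj : Set.InjOn (fun i : ℕ => α ^ Fintype.card F ^ i) (Set.Iio p.1.natDegree) := by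
    intro i hi j hj hij
    rw [← horder] at hi hj
    refine pow_injOn_Iio_orderOf hi hj (AdjoinRoot.algHom_ext ?_)
    rw [hfrob, hfrob]
    apply φ.toRingHom.injective
    simpa [hφ] using hij
  have hnodup : ((Multiset.range p.1.natDegree).map fun i => α ^ Fintype.card F ^ i).Nodup := by
    refine Multiset.Nodup.map_on (fun i hi j hj h => hinj ?_ ?_ h) (Multiset.nodup_range _)
    · exact Multiset.mem_range.mp hi
    · exact Multiset.mem_range.mp hj
  symm
  refine Multiset.eq_of_le_of_card_le ((Multiset.le_iff_subset hnodup).mpr ?_) ?_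
  · intro x hx
    obtain ⟨i, -, rfl⟩ := Multiset.mem_map.mp hx
    rw [mem_aroots]
    exact ⟨p.2.2.ne_zero, by
      rw [aeval_pow_card_pow, hα, zero_pow (pow_ne_zero _ Fintype.card_ne_zero)]⟩
  · rw [Multiset.card_map, Multiset.card_range]
    exact (card_roots' _).trans (natDegree_map_le)

theorem frobProd_fin_one {R : Type*} [CommRing R] [Algebra F R] (A : Matrix (Fin 1) (Fin 1) R[X])
    (d : ℕ) : frobProd (F := F) A d 0 0 =
      ∏ i ∈ range d, ((coeffFrob F R)^[i]) (A 0 0) := by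
  induction d with
  | zero => simp [frobProd]
  | succ d ih =>
    rw [frobProd, Matrix.mul_apply, Fin.sum_univ_one, ih, prod_range_succ, mul_comm]
    rfl

theorem coeff_iterate_coeffFrob {R : Type*} [CommRing R] [Algebra F R] (i : ℕ) (f : R[X]) (k : ℕ) :
    ((coeffFrob F R)^[i] f).coeff k = f.coeff k ^ Fintype.card F ^ i := by
  induction i with
  | zero => simp
  | succ i ih =>
    rw [Function.iterate_succ_apply', coeffFrob, coe_mapRingHom, coeff_map]
    rw [coeffFrob, coe_mapRingHom] at ih
    rw [ih, pow_succ, pow_mul]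
    rfl

/-- The local determinant at `𝔓` is `1 - ∏ Q(α) U^(deg 𝔓)` over the roots `α` of `𝔓`. -/
theorem map_localDet_fin_one [IsAlgClosed K] (Q : Matrix (Fin 1) (Fin 1) F[X][X])
    (p : FinitePrime F) : (localDet Q p).map (mapRingHom (algebraMap F K)) =
      1 - X ^ p.1.natDegree * C (rootProd K (Q 0 0) p.1) := by
  obtain ⟨α, hα⟩ := IsAlgClosed.exists_aeval_eq_zero K p.1
    (degree_pos_of_irreducible p.2.2).ne'
  let φ : Residue p.1 →ₐ[F] K := AdjoinRoot.liftAlgHom p.1 (Algebra.ofId F K) α hα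
  have hφ : ∀ f : F[X], φ (AdjoinRoot.mk p.1 f) = aeval α f := fun f =>
    AdjoinRoot.liftAlgHom_mk _ _ _ hα f
  have h1 : mapRingHom (algebraMap F K) =
      (mapRingHom φ.toRingHom).comp (mapRingHom (algebraMap F (Residue p.1))) := by
    rw [mapRingHom_comp]
    congr 1
    exact φ.comp_algebraMap.symm
  rw [h1, ← Polynomial.map_map, localDet_spec, frobDet, Matrix.det_fin_one]
  simp only [Matrix.sub_apply, Matrix.one_apply_eq, Matrix.smul_apply, Matrix.map_apply,
    smul_eq_mul, Polynomial.map_sub, Polynomial.map_one, Polynomial.map_mul, Polynomial.map_pow,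
    map_X, map_C, frobProd_fin_one]
  congr 3
  rw [map_prod]
  rw [rootProd, aroots_finitePrime p hα, Multiset.map_map, prod_eq_multiset_prod]
  congr 2
  funext i
  ext k
  simp only [coe_mapRingHom, Function.comp_apply, coeff_map, coeff_iterate_coeffFrob, reduce,
    Matrix.map_apply]
  change φ _ = aeval _ _
  rw [map_pow, hφ, aeval_pow_card_pow]

end Roots

end CarlitzTwist

/-! ### The `L`-series of a triangular matrix -/

namespace CarlitzTwist

section IntCoeff

variable {F : Type u} [Field F]

theorem intCoeff_natCast (P : F[X]) (s : ℕ) : intCoeff P s = P.coeff s := by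
  simp [intCoeff]

theorem intCoeff_of_neg (P : F[X]) {z : ℤ} (hz : z < 0) : intCoeff P z = 0 :=
  if_neg (not_le.mpr hz)

theorem intCoeff_one_of_ne_zero {z : ℤ} (hz : z ≠ 0) : intCoeff (1 : F[X]) z = 0 := by
  rw [intCoeff]
  split_ifs with h
  · rw [coeff_one, if_neg (by omega)]
  · rfl

end IntCoeff

section Trace

open Finset

variable {F : Type u} [Field F] [Fintype F] {K : Type*} [Field K] [Algebra F K]

/-- The sum of `∏ Q(α)`, over the roots `α` of `f`, over all monic `f` of degree `n`. Here `Q'` is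
the polynomial `Q` rewritten as a polynomial in `θ` over `K[T]`. -/
theorem sum_rootProd [IsAlgClosed K] {Q : F[X][X]} {Q' : K[X][X]}
    (hQ : ∀ α : K, Q'.eval (C α) = Q.map (aeval α : F[X] →ₐ[F] K).toRingHom) {r : ℕ}
    (hlow : ∀ a b, a < b → (Q' * X ^ a).coeff (Fintype.card F * (b + 1) - 1) = 0)
    (hdiag : ∀ a, (Q' * X ^ a).coeff (Fintype.card F * (a + 1) - 1) = if a < r then 1 else 0)
    (n : ℕ) : ∑ f ∈ monicFinset F n, rootProd K Q f = (-1) ^ n * (r.choose n : K[X]) := by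
  classical
  have hsymm : (∏ i, aeval (MvPolynomial.X i : MvPolynomial (Fin n) K[X]) Q').IsSymmetric := by
    intro σ
    rw [map_prod]
    refine Fintype.prod_equiv σ _ _ fun i => ?_
    rw [← aeval_algHom_apply, MvPolynomial.rename_X]
  obtain ⟨G, hG⟩ := MvPolynomial.esymmAlgHom_fin_surjective K[X] (le_refl n) ⟨_, hsymm⟩
  have hG' : MvPolynomial.esymmSubst n K[X] G =
      ∏ i, aeval (MvPolynomial.X i : MvPolynomial (Fin n) K[X]) Q' := by
    rw [MvPolynomial.esymmSubst, ← MvPolynomial.esymmAlgHom_apply, hG]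
  rw [← MvPolynomial.sum_eval_of_esymmSubst_eq_prod (F := F) hlow hdiag hG', monicFinset,
    sum_image (monicOfEsymm_injective n).injOn]
  refine sum_congr rfl fun c _ => ?_
  have hcard : ((monicOfEsymm c).aroots K).card = n := by
    rw [aroots_def, IsAlgClosed.card_roots_eq_natDegree, natDegree_map, natDegree_monicOfEsymm]
  -- An enumeration of the roots, with multiplicity.
  obtain ⟨α, hα⟩ : ∃ α : Fin n → K, (univ : Finset (Fin n)).val.map α =
      (monicOfEsymm c).aroots K := by
    refine ⟨fun i => ((monicOfEsymm c).aroots K).toList.get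
      (i.cast (by rw [Multiset.length_toList, hcard])), ?_⟩
    rw [Fin.univ_val_map]
    conv_rhs => rw [← Multiset.coe_toList ((monicOfEsymm c).aroots K)]
    congr 1
    apply List.ext_get
    · simp [hcard]
    · intro k h1 h2
      simp
  have hc : ∀ i : Fin n, algebraMap F K (c i) =
      MvPolynomial.aeval α (MvPolynomial.esymm (Fin n) F (i + 1)) := by
    intro i
    rw [MvPolynomial.aeval_esymm_eq_multiset_esymm, hα]
    have hi := i.2
    have h1 := coeff_eq_esymm_roots_of_card
      (p := (monicOfEsymm c).map (algebraMap F K)) (k := n - (i + 1))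
      (by rw [IsAlgClosed.card_roots_eq_natDegree]) (by
        rw [natDegree_map, natDegree_monicOfEsymm]; omega)
    rw [coeff_map, coeff_monicOfEsymm, ((monic_monicOfEsymm c).map _).leadingCoeff, one_mul,
      natDegree_map, natDegree_monicOfEsymm, Nat.sub_sub_self (by omega), map_mul, map_pow, map_neg,
      map_one] at h1
    exact mul_left_cancel₀ (pow_ne_zero _ (neg_ne_zero.mpr one_ne_zero)) h1
  have hev : MvPolynomial.eval (fun i => C (α i)) (MvPolynomial.esymmSubst n K[X] G) =
      MvPolynomial.eval (fun i => algebraMap F K[X] (c i)) G := by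
    rw [MvPolynomial.esymmSubst, ← MvPolynomial.coe_aeval_eq_eval, ← MvPolynomial.coe_aeval_eq_eval,
      RingHom.coe_coe, RingHom.coe_coe, ← AlgHom.comp_apply, MvPolynomial.comp_aeval]
    congr 2
    funext i
    rw [IsScalarTower.algebraMap_apply F K K[X], hc, algebraMap_eq]
    simp [MvPolynomial.esymm, map_sum, map_prod]
  rw [← hev, hG', map_prod, rootProd, ← hα, Multiset.map_map]
  refine prod_congr rfl fun i _ => ?_
  rw [Function.comp_apply, ← hQ, aeval_def, hom_eval₂, MvPolynomial.algebraMap_eq,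
    MvPolynomial.eval_X, show (MvPolynomial.eval fun i => C (α i)).comp MvPolynomial.C =
      RingHom.id K[X] from RingHom.ext fun x => MvPolynomial.eval_C x]
  rfl

theorem one_sub_X_pow {R : Type*} [CommRing R] (r : ℕ) :
    (1 - X : R[X]) ^ r = C ((-1) ^ r) * (X - C 1) ^ r := by
  rw [C_pow, C_neg, C_1, ← mul_pow]
  congr 1
  ring

/-- If the operator `p ↦ cartier (Q' * p)` on `K[T][θ]` is triangular with diagonal entries `1` (`r`
times) and `0` otherwise, then `L = (1 - U) ^ r`. -/
theorem LSeries_eq_of_triangular [IsAlgClosed K] {Q : Matrix (Fin 1) (Fin 1) F[X][X]} {Q' : K[X][X]}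
    (hQ : ∀ α : K, Q'.eval (C α) = (Q 0 0).map (aeval α : F[X] →ₐ[F] K).toRingHom) {r : ℕ}
    (hlow : ∀ a b, a < b → (Q' * X ^ a).coeff (Fintype.card F * (b + 1) - 1) = 0)
    (hdiag : ∀ a, (Q' * X ^ a).coeff (Fintype.card F * (a + 1) - 1) = if a < r then 1 else 0) :
    (((1 - X) ^ r : F[X][X]) : PowerSeries F[X]) = LSeries Q := by
  ext1 n
  apply map_injective (algebraMap F K) (algebraMap F K).injective
  rw [← coe_mapRingHom, map_coeff_LSeries (rootProd_one _) (fun f g => rootProd_mul _)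
    (mapRingHom (algebraMap F K)) (map_localDet_fin_one Q), sum_rootProd hQ hlow hdiag]
  have h : ((1 - X) ^ r : F[X][X]).coeff n = (-1) ^ n * (r.choose n : F[X]) := by
    have h1 : (X - C 1 : F[X][X]) = X + C (-1) := by rw [C_neg, sub_eq_add_neg]
    rw [one_sub_X_pow, h1, coeff_C_mul, coeff_X_add_C_pow, ← mul_assoc, ← pow_add]
    rcases le_or_gt n r with hn | hn
    · congr 1
      rw [show r + (r - n) = n + 2 * (r - n) by omega, pow_add, pow_mul]
      simp
    · rw [Nat.choose_eq_zero_of_lt hn]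
      simp
  rw [coeff_coe, h]
  simp

/-- The entry `a_{iq-j} T - a_{iq-j-1}`, `i = b + 1`, `j = a + 1`, of the infinite matrix of which
`carlitzMatrix P k` is the upper left corner. -/
def carlitzEntry (P : F[X]) (b a : ℕ) : F[X] :=
  C (intCoeff P (((b : ℤ) + 1) * Fintype.card F - ((a : ℤ) + 1))) * X -
    C (intCoeff P (((b : ℤ) + 1) * Fintype.card F - ((a : ℤ) + 1) - 1))

/-- `P (T - θ)` as a polynomial in `θ` over `K[T]`. -/
def carlitzTheta (K : Type*) [Field K] [Algebra F K] (P : F[X]) : K[X][X] :=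
  P.map (C.comp (algebraMap F K)) * (C X - X)

theorem coeff_carlitzTheta_mul_X_pow (P : F[X]) (a b : ℕ) :
    (carlitzTheta K P * X ^ a).coeff (Fintype.card F * (b + 1) - 1) =
      mapRingHom (algebraMap F K) (carlitzEntry P b a) := by
  have hq : 0 < Fintype.card F * (b + 1) := Nat.mul_pos Fintype.card_pos (Nat.succ_pos _)
  have hz : ((b : ℤ) + 1) * Fintype.card F - ((a : ℤ) + 1) =
      ((Fintype.card F * (b + 1) : ℕ) : ℤ) - 1 - a := by
    push_cast
    ring
  rw [coeff_mul_X_pow', carlitzEntry, hz]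
  generalize Fintype.card F * (b + 1) = N at hq
  split_ifs with h
  · obtain ⟨s, hs⟩ := Nat.exists_eq_add_of_le h
    have hs' : (N : ℤ) - 1 - a = s := by omega
    rw [hs', hs, Nat.add_sub_cancel_left, carlitzTheta, mul_sub, coeff_sub, coeff_mul_C, coeff_map,
      intCoeff_natCast]
    rcases s with _ | s
    · rw [coeff_mul_X_zero, intCoeff_of_neg P (by norm_num)]
      simp
    · rw [coeff_mul_X, coeff_map, Nat.cast_succ, add_sub_cancel_right, intCoeff_natCast]
      simp
  · rw [intCoeff_of_neg P (by omega), intCoeff_of_neg P (by omega)]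
    simp

/-- If the infinite matrix attached to `P` is triangular with diagonal entries `1` (`r` times) and
`0` otherwise, then `L(ℭ_P, U) = (1 - U) ^ r`. -/
theorem hasAnalyticRank_of_triangular {P : F[X]} (hP : P ≠ 0) {r : ℕ}
    (hlow : ∀ a b : ℕ, a < b → carlitzEntry P b a = 0)
    (hdiag : ∀ a : ℕ, carlitzEntry P a a = if a < r then 1 else 0) :
    HasAnalyticRank (twistedCarlitz P hP) (carlitzBasis P hP) r := by
  have hne : (1 - X : F[X][X]) ^ r ≠ 0 := by
    rw [one_sub_X_pow]
    exact mul_ne_zero (C_ne_zero.mpr (by simp)) (pow_ne_zero _ (X_sub_C_ne_zero 1))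
  refine ⟨_, twistedCarlitz_isIntegralMatrix P hP, (1 - X) ^ r, LSeries_eq_of_triangular
    (K := AlgebraicClosure F) (Q' := carlitzTheta (AlgebraicClosure F) P) ?_ ?_ ?_, hne, ?_⟩
  · intro α
    rw [carlitzTheta, eval_mul, eval_map]
    simp only [eval_sub, eval_C, eval_X, Polynomial.map_mul, Polynomial.map_sub, map_C, map_X]
    congr 1
    · rw [← hom_eval₂]
      rfl
    · simp
  · intro a b h
    rw [coeff_carlitzTheta_mul_X_pow, hlow a b h, map_zero]
  · intro a
    rw [coeff_carlitzTheta_mul_X_pow, hdiag]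
    split_ifs <;> simp
  · have h1 := rootMultiplicity_X_sub_C_pow (1 : F[X]) r
    rw [one_sub_X_pow] at hne ⊢
    rw [rootMultiplicity_mul hne, rootMultiplicity_C, zero_add, h1]

end Trace

/-! ### The example polynomial -/

section Example

variable (F : Type u) [Field F] [Fintype F]

open Classical in
theorem coeff_examplePoly (r s : ℕ) : (examplePoly F r).coeff s =
    if ∃ m, 1 ≤ m ∧ m ≤ r ∧ s + 1 = m * (Fintype.card F - 1) then -1 else 0 := by
  classical
  have hq : 0 < Fintype.card F - 1 := Nat.sub_pos_of_lt Fintype.one_lt_card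
  simp only [examplePoly, finsetSum_coeff, coeff_C_mul, coeff_X_pow]
  have hiff : ∀ m, 1 ≤ m → (s = m * (Fintype.card F - 1) - 1 ↔
      s + 1 = m * (Fintype.card F - 1)) := by
    intro m hm
    have : 0 < m * (Fintype.card F - 1) := Nat.mul_pos hm hq
    omega
  split_ifs with h
  · obtain ⟨m, h1, h2, h3⟩ := h
    rw [Finset.sum_eq_single m]
    · rw [if_pos ((hiff m h1).mpr h3), mul_one]
    · intro m' hm' hne
      rw [if_neg, mul_zero]
      intro heq
      rw [hiff m' (Finset.mem_Icc.mp hm').1, h3] at heq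
      exact hne (Nat.eq_of_mul_eq_mul_right hq heq).symm
    · exact fun hm => absurd (Finset.mem_Icc.mpr ⟨h1, h2⟩) hm
  · refine Finset.sum_eq_zero fun m hm => ?_
    rw [Finset.mem_Icc] at hm
    rw [if_neg, mul_zero]
    intro heq
    exact h ⟨m, hm.1, hm.2, (hiff m hm.1).mp heq⟩

theorem examplePoly_ne_zero {r : ℕ} (hr : 1 ≤ r) : examplePoly F r ≠ 0 := by
  have hq : 0 < Fintype.card F - 1 := Nat.sub_pos_of_lt Fintype.one_lt_card
  intro h
  have h1 := coeff_examplePoly F r (1 * (Fintype.card F - 1) - 1)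
  rw [if_pos ⟨1, le_rfl, hr, by omega⟩, h] at h1
  simp at h1

open Classical in
theorem intCoeff_examplePoly (r : ℕ) (z : ℤ) : intCoeff (examplePoly F r) z =
    if ∃ m : ℕ, 1 ≤ m ∧ m ≤ r ∧ z + 1 = m * ((Fintype.card F : ℤ) - 1) then -1 else 0 := by
  classical
  have hq : 1 < Fintype.card F := Fintype.one_lt_card
  rcases lt_or_ge z 0 with hz | hz
  · rw [intCoeff_of_neg _ hz, if_neg]
    rintro ⟨m, h1, -, h3⟩
    have : 0 < (m : ℤ) * ((Fintype.card F : ℤ) - 1) := mul_pos (by omega) (by omega)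
    omega
  · obtain ⟨s, rfl⟩ := Int.eq_ofNat_of_zero_le hz
    rw [intCoeff_natCast, coeff_examplePoly]
    refine if_congr (exists_congr fun m => and_congr_right' (and_congr_right' ?_)) rfl rfl
    rw [← Nat.cast_inj (R := ℤ), Nat.cast_mul, Nat.cast_sub hq.le]
    push_cast
    rfl

theorem intCoeff_examplePoly_mul_sub_one (r k : ℕ) :
    intCoeff (examplePoly F r) ((k + 1) * ((Fintype.card F : ℤ) - 1) - 1) =
      if k < r then -1 else 0 := by
  have hq : 1 < Fintype.card F := Fintype.one_lt_card
  rw [intCoeff_examplePoly]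
  classical
  refine if_congr ⟨?_, fun h => ⟨k + 1, by omega, by omega, by push_cast; ring⟩⟩ rfl rfl
  rintro ⟨m, -, h2, h3⟩
  rw [sub_add_cancel] at h3
  have := mul_right_cancel₀ (by omega) h3
  omega

/-- For `z = (k + 1) (q - 1) - 1 + e` with `1 ≤ e ≤ k + 1` the coefficient `a_z` vanishes: if
`z + 1 = m (q - 1)`, then `q - 1` divides `e`, so that `k + 1 ≥ q - 1` and `m ≥ k + 2 > q - 1 ≥ r`. -/
theorem intCoeff_examplePoly_eq_zero {r : ℕ} (hr : r ≤ Fintype.card F - 1) {k e : ℕ} (he : 0 < e)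
    (hek : e ≤ k + 1) :
    intCoeff (examplePoly F r) ((k + 1) * ((Fintype.card F : ℤ) - 1) - 1 + e) = 0 := by
  have hq : 1 < Fintype.card F := Fintype.one_lt_card
  rw [intCoeff_examplePoly, if_neg]
  rintro ⟨m, -, h2, h3⟩
  obtain ⟨s, hs⟩ : ∃ s : ℕ, Fintype.card F = s + 1 := ⟨Fintype.card F - 1, by omega⟩
  rw [hs] at h3 hr hq
  push_cast at h3
  have h4 : (e : ℤ) = ((m : ℤ) - (k + 1)) * s := by linear_combination h3
  have h5 : (1 : ℤ) ≤ (m : ℤ) - (k + 1) := by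
    by_contra hcon
    have : ((m : ℤ) - (k + 1)) * s ≤ 0 := mul_nonpos_of_nonpos_of_nonneg (by omega) (by omega)
    omega
  have h6 : (s : ℤ) ≤ e := by
    rw [h4]
    exact le_mul_of_one_le_left (by omega) h5
  omega

theorem carlitzEntry_examplePoly_of_lt {r : ℕ} (hr : r ≤ Fintype.card F - 1) {a b : ℕ}
    (hab : a < b) : carlitzEntry (examplePoly F r) b a = 0 := by
  obtain ⟨e, rfl⟩ := Nat.exists_eq_add_of_lt hab
  have h1 : (((a + e + 1 : ℕ) : ℤ) + 1) * Fintype.card F - ((a : ℤ) + 1) =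
      (((a + e + 1 : ℕ) : ℤ) + 1) * ((Fintype.card F : ℤ) - 1) - 1 + ((e + 2 : ℕ) : ℤ) := by
    push_cast
    ring
  have h2 : (((a + e + 1 : ℕ) : ℤ) + 1) * Fintype.card F - ((a : ℤ) + 1) - 1 =
      (((a + e + 1 : ℕ) : ℤ) + 1) * ((Fintype.card F : ℤ) - 1) - 1 + ((e + 1 : ℕ) : ℤ) := by
    push_cast
    ring
  rw [carlitzEntry, h2, h1, intCoeff_examplePoly_eq_zero F hr (by omega) (by omega),
    intCoeff_examplePoly_eq_zero F hr (by omega) (by omega)]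
  simp

theorem carlitzEntry_examplePoly_self {r : ℕ} (hr : r ≤ Fintype.card F - 1) (a : ℕ) :
    carlitzEntry (examplePoly F r) a a = if a < r then 1 else 0 := by
  have h1 : ((a : ℤ) + 1) * Fintype.card F - ((a : ℤ) + 1) =
      ((a : ℤ) + 1) * ((Fintype.card F : ℤ) - 1) - 1 + ((1 : ℕ) : ℤ) := by
    push_cast
    ring
  have h2 : ((a : ℤ) + 1) * Fintype.card F - ((a : ℤ) + 1) - 1 =
      ((a : ℤ) + 1) * ((Fintype.card F : ℤ) - 1) - 1 := by
    ring
  rw [carlitzEntry, h2, h1, intCoeff_examplePoly_mul_sub_one,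
    intCoeff_examplePoly_eq_zero F hr one_pos (by omega)]
  split_ifs <;> simp

variable {F}

theorem carlitzEntry_one (hq : 2 < Fintype.card F) {a b : ℕ} (hab : a ≤ b) :
    carlitzEntry (1 : F[X]) b a = 0 := by
  have h1 : ((b : ℤ) + 1) * 3 ≤ ((b : ℤ) + 1) * Fintype.card F :=
    mul_le_mul_of_nonneg_left (by omega) (by omega)
  rw [carlitzEntry, intCoeff_one_of_ne_zero (by omega), intCoeff_one_of_ne_zero (by omega)]
  simp

end Example

end CarlitzTwist

end

theorem proposition6p1 (F : Type*) [Field F] [Fintype F] (r : ℕ) (hr : r ≤ Fintype.card F - 1) :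
    (¬ (Fintype.card F = 2 ∧ r = 0) →
      ∃ (P : Polynomial F) (hP : P ≠ 0),
        CarlitzTwist.HasAnalyticRank (CarlitzTwist.twistedCarlitz P hP)
          (CarlitzTwist.carlitzBasis P hP) r) ∧
    (1 ≤ r →
      (∃ hP : CarlitzTwist.examplePoly F r ≠ 0,
        CarlitzTwist.HasAnalyticRank (CarlitzTwist.twistedCarlitz (CarlitzTwist.examplePoly F r) hP)
          (CarlitzTwist.carlitzBasis (CarlitzTwist.examplePoly F r) hP) r) ∧
      (CarlitzTwist.carlitzMatrix (CarlitzTwist.examplePoly F r) r).BlockTriangular id ∧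
      ∀ i, CarlitzTwist.carlitzMatrix (CarlitzTwist.examplePoly F r) r i i = 1) := by
  have hexample : ∀ hP : CarlitzTwist.examplePoly F r ≠ 0,
      CarlitzTwist.HasAnalyticRank (CarlitzTwist.twistedCarlitz (CarlitzTwist.examplePoly F r) hP)
        (CarlitzTwist.carlitzBasis (CarlitzTwist.examplePoly F r) hP) r := fun hP =>
    CarlitzTwist.hasAnalyticRank_of_triangular hP
      (fun _ _ => CarlitzTwist.carlitzEntry_examplePoly_of_lt F hr)
      (CarlitzTwist.carlitzEntry_examplePoly_self F hr)
  refine ⟨fun hne => ?_, fun h1 => ⟨⟨CarlitzTwist.examplePoly_ne_zero F h1, hexample _⟩, ?_, ?_⟩⟩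
  · rcases Nat.eq_zero_or_pos r with rfl | h1
    · have h2 : 1 < Fintype.card F := Fintype.one_lt_card
      have hq : 2 < Fintype.card F := by
        by_contra hcon
        exact hne ⟨by omega, rfl⟩
      exact ⟨1, one_ne_zero, CarlitzTwist.hasAnalyticRank_of_triangular one_ne_zero
        (fun _ _ h => CarlitzTwist.carlitzEntry_one hq h.le)
        (fun _ => (CarlitzTwist.carlitzEntry_one hq le_rfl).trans (if_neg (Nat.not_lt_zero _)).symm)⟩
    · exact ⟨_, CarlitzTwist.examplePoly_ne_zero F h1, hexample _⟩
  · exact fun i j hij => CarlitzTwist.carlitzEntry_examplePoly_of_lt F hr hij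
  · exact fun i => (CarlitzTwist.carlitzEntry_examplePoly_self F hr i).trans (if_pos i.2)
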